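/- **Proposition 3.3 (label choice).** Let $S^1$ carry normalized Haar measure, let $n\ge 0$, $k\ge 2$, let $\omega$ be a primitive $k$-th root of unity, let $(Sf)(\lambda)=\lambda f(\lambda)$ be the shift on $L^2=L^2(S^1,\mathbb C^n)$, and let $\mathcal H_+\subset L^2$ be the Hardy space of functions whose negative Fourier coefficients vanish. A subspace $W\subseteq L^2$ is called *$k$-symmetric shift-invariant* if $SW\subseteq W$ and $f_\omega\in W$ for all $f\in W$, where $f_\omega(\lambda)=f(\omega\lambda)$. For such $W$ and $0\le j\le k-1$ put $$W_j=\{f\in W: f_\omega=\omega^jf\},\qquad V_j=\{f\in L^2:\ \lambda\mapsto\lambda^jf(\lambda^k)\ \text{lies in } W_j\}.$$ **(a)** Let $W$ be $k$-symmetric shift-invariant with $W=\Phi\mathcal H_+$, where $\Phi$ is a measurable matrix-valued function on $S^1$ which is $\mathrm U(n)$-valued a.e. Then there is a constant $\varphi_k\in \mathrm U(n)$ with $\varphi_k^k=I$ such that $\Phi(\omega\lambda)=\Phi(\lambda)\varphi_k$ for a.e. $\lambda$. Put $\beta_j=\ker(\varphi_k-\omega^jI)$ and let $\pi_j$ be the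 orthogonal projection of $\mathbb C^n$ onto $\beta_j$ $(0\le j\le k-1)$; the $\beta_j$ are pairwise orthogonal. Then $$\Phi_k(\lambda)=\Phi(\lambda)\sum_{j=0}^{k-1}\pi_j\lambda^{-j}$$ agrees a.e. with a measurable function of $\lambda^k$, and with $$\Psi(\lambda)=\Phi_k(\lambda^{1/k})\quad\text{(for any choice of $k$-th roots, so that } \Psi(\lambda^k)=\Phi_k(\lambda)\text{ a.e.)},\qquad \alpha_j=\bigoplus_{l=0}^{j}\beta_l ,$$ the following hold: $\Psi$ is measurable and $\mathrm U(n)$-valued a.e.; $W_j=\{\lambda\mapsto\lambda^jf(\lambda^k): f\in V_j\}$ for $0\le j\le k-1$; $V_{k-1}=\Psi\mathcal H_+$; $\alpha_0\subseteq\alpha_1\subseteq\dots\subseteq\alpha_{k-2}$; for $0\le j\le k-2$, $$V_j=\Psi(\pi_{\alpha_j}+\lambda\pi_{\alpha_j}^{\perp})\mathcal H_+=\Psi(\alpha_j+\lambda\mathcal H_+),$$ where $\pi_{\alpha_j}$, $\pi_{\alpha_j}^\perp$ are the orthogonal projections onto $\alpha_j$ and $\alpha_j^\perp$; and $$W=\Psi(\lambda^k)\bigl(\alpha_0+\lambda\alpha_1+\dots+\lambda^{k-2}\alpha_{k-2}+\lambda^{k-1}\mathcal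 H_+\bigr).$$ **(b)** Let $M$ be a smooth manifold (for instance a Riemann surface), let $\Phi:S^1\times M\to \mathrm U(n)$ be smooth with $\Phi(1,\cdot)=I$, and suppose that $W(z)=\Phi(\cdot,z)\mathcal H_+$ is $k$-symmetric shift-invariant for every $z\in M$. Then there is $\varphi_k:M\to\mathrm U(n)$ with $\varphi_k(z)^k=I$ and $\Phi(\omega\lambda,z)=\Phi(\lambda,z)\varphi_k(z)$ for all $\lambda\in S^1$, $z\in M$. With $\beta_j(z)$ (again pairwise orthogonal), $\Phi_k(\lambda,z)$, $\alpha_j(z)$ and $\Psi(\lambda,z)=\Phi_k(\lambda^{1/k},z)$ formed as in (a) for each $z$, one has $\Psi(\lambda^k,z)=\Phi_k(\lambda,z)$ for all $\lambda,z$; the conclusions of (a) on $\Psi$, $\alpha_j$, $V_j$, $W$ hold at every $z$; $\Psi$ is a smooth map $S^1\times M\to \mathrm U(n)$ with $\Psi(1,\cdot)=I$; and $\alpha_0,\dots,\alpha_{k-2}$ are smooth subbundles of the trivial bundle $M\times\mathbb C^n$. -/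

import Mathlib

open MeasureTheory

namespace KSymmetric

noncomputable section

instance instMeasurableSpaceCircle : MeasurableSpace Circle := borel Circle

instance instBorelSpaceCircle : BorelSpace Circle := ⟨rfl⟩

/-- Normalized Haar measure on the unit circle. -/
def circleMeasure : Measure Circle := Measure.haarMeasure ⊤

instance instIsHaarMeasure : circleMeasure.IsHaarMeasure := by
  unfold circleMeasure; infer_instance

instance instIsProbabilityMeasure : IsProbabilityMeasure circleMeasure :=
  ⟨by simpa [circleMeasure] using Measure.haarMeasure_self (K₀ := (⊤ : TopologicalSpace.PositiveCompacts Circle))⟩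

/-- The Hermitian space `ℂⁿ`. -/
abbrev Cn (n : ℕ) : Type := EuclideanSpace ℂ (Fin n)

/-- Complex `n × n` matrices. -/
abbrev Mat (n : ℕ) : Type := Matrix (Fin n) (Fin n) ℂ

/-- The unitary group `U(n)`. -/
abbrev Un (n : ℕ) : Submonoid (Mat n) := Matrix.unitaryGroup (Fin n) ℂ

/-- `L²(S¹, ℂⁿ)`. -/
abbrev L2 (n : ℕ) : Type := Lp (Cn n) 2 circleMeasure

/-- A matrix acting on a vector of `ℂⁿ`. -/
def act {n : ℕ} (A : Mat n) (v : Cn n) : Cn n := Matrix.toEuclideanCLM (𝕜 := ℂ) A v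

theorem memLp_smul {n : ℕ} {c : Circle → Circle} (hc : Continuous c) (f : L2 n) :
    MemLp (fun x : Circle => ((c x : Circle) : ℂ) • f x) 2 circleMeasure := by
  refine (Lp.memLp f).of_le ?_ ?_
  · exact (continuous_subtype_val.comp hc).aestronglyMeasurable.smul (Lp.aestronglyMeasurable f)
  · exact Filter.Eventually.of_forall fun x => by rw [norm_smul, Circle.norm_coe, one_mul]

/-- The forward shift `(S f)(λ) = λ f(λ)` on `L²(S¹, ℂⁿ)`. -/
def shift (n : ℕ) : L2 n →ₗ[ℂ] L2 n where
  toFun f := (memLp_smul continuous_id f).toLp _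
  map_add' f g := by
    rw [← MemLp.toLp_add]
    refine MemLp.toLp_congr _ _ ?_
    filter_upwards [Lp.coeFn_add f g] with x hx
    simp only [Pi.add_apply, hx, smul_add]
  map_smul' a f := by
    rw [RingHom.id_apply, ← MemLp.toLp_const_smul]
    refine MemLp.toLp_congr _ _ ?_
    filter_upwards [Lp.coeFn_smul a f] with x hx
    simp only [Pi.smul_apply, hx, smul_comm a]

/-- The rotation `f ↦ f_ω`, `f_ω(λ) = f(ωλ)`, on `L²(S¹, ℂⁿ)`. -/
def rot (n : ℕ) (ω : Circle) : L2 n →ₗ[ℂ] L2 n :=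
  Lp.compMeasurePreservingₗ ℂ (fun x => ω * x) (measurePreserving_mul_left circleMeasure ω)

theorem measurePreserving_pow (k : ℕ) [NeZero k] :
    MeasurePreserving (fun x : Circle => x ^ k) circleMeasure circleMeasure := by
  refine (powMonoidHom k : Circle →* Circle).measurePreserving (continuous_pow k) ?_ rfl
  intro x
  refine ⟨Circle.exp (Complex.arg x / k), ?_⟩
  have hk : (k : ℝ) ≠ 0 := Nat.cast_ne_zero.mpr (NeZero.ne k)
  rw [powMonoidHom_apply, ← Circle.exp_nsmul, nsmul_eq_mul, mul_div_cancel₀ _ hk, Circle.exp_arg]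

/-- The map sending `f` to the function `λ ↦ f(λᵏ)` on `L²(S¹, ℂⁿ)`. -/
def powComp (n k : ℕ) [NeZero k] : L2 n →ₗ[ℂ] L2 n :=
  Lp.compMeasurePreservingₗ ℂ (fun x => x ^ k) (measurePreserving_pow k)

/-- The Fourier coefficient `∫ λ⁻ᵐ f(λ)` with respect to normalized Haar measure. -/
def fourierCoefficient {n : ℕ} (f : L2 n) (m : ℤ) : Cn n :=
  ∫ x : Circle, ((x ^ (-m) : Circle) : ℂ) • f x ∂circleMeasure

theorem integrable_smul {n : ℕ} (f : L2 n) (m : ℤ) :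
    Integrable (fun x : Circle => ((x ^ (-m) : Circle) : ℂ) • f x) circleMeasure :=
  (memLp_smul (continuous_zpow (-m)) f).integrable (by norm_num)

/-- The Hardy space `H₊`: functions in `L²(S¹, ℂⁿ)` whose negative Fourier coefficients vanish. -/
def hardy (n : ℕ) : Submodule ℂ (L2 n) where
  carrier := {f | ∀ m : ℤ, m < 0 → fourierCoefficient f m = 0}
  zero_mem' := by
    intro m _
    rw [fourierCoefficient]
    refine integral_eq_zero_of_ae ?_
    filter_upwards [Lp.coeFn_zero (Cn n) 2 circleMeasure] with x hx
    simp only [hx, Pi.zero_apply, smul_zero]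
  add_mem' := by
    intro f g hf hg m hm
    have h : fourierCoefficient (f + g) m = fourierCoefficient f m + fourierCoefficient g m := by
      rw [fourierCoefficient, fourierCoefficient, fourierCoefficient,
        ← integral_add (integrable_smul f m) (integrable_smul g m)]
      refine integral_congr_ae ?_
      filter_upwards [Lp.coeFn_add f g] with x hx
      rw [hx, Pi.add_apply, smul_add]
    rw [h, hf m hm, hg m hm, add_zero]
  smul_mem' := by
    intro a f hf m hm
    have h : fourierCoefficient (a • f) m = a • fourierCoefficient f m := by
      rw [fourierCoefficient, fourierCoefficient, ← integral_smul]
      refine integral_congr_ae ?_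
      filter_upwards [Lp.coeFn_smul a f] with x hx
      rw [hx, Pi.smul_apply, smul_comm]
    rw [h, hf m hm, smul_zero]

/-- A matrix-valued function on the circle is (Lebesgue) measurable: each entry agrees almost
everywhere with a Borel function. -/
def IsMeasurable {n : ℕ} (F : Circle → Mat n) : Prop :=
  ∀ a b : Fin n, AEMeasurable (fun x => F x a b) circleMeasure

/-- The space `F A = {F h : h ∈ A}` for a matrix-valued function `F` on the circle and a space `A`
of functions (products that are not in `L²` are ignored; there are none when `F` is measurable and
unitary-valued almost everywhere). -/
def mulImage {n : ℕ} (F : Circle → Mat n) (A : Submodule ℂ (L2 n)) : Submodule ℂ (L2 n) where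
  carrier := {f | ∃ h ∈ A, ∀ᵐ x ∂circleMeasure, f x = act (F x) (h x)}
  zero_mem' := by
    refine ⟨0, A.zero_mem, ?_⟩
    filter_upwards [Lp.coeFn_zero (Cn n) 2 circleMeasure] with x hx
    rw [hx, Pi.zero_apply, act, map_zero]
  add_mem' := by
    rintro f g ⟨h, hA, hh⟩ ⟨h', hA', hh'⟩
    refine ⟨h + h', A.add_mem hA hA', ?_⟩
    filter_upwards [hh, hh', Lp.coeFn_add f g, Lp.coeFn_add h h'] with x h1 h2 h3 h4
    rw [h3, Pi.add_apply, h1, h2, h4, Pi.add_apply, act, act, act, map_add]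
  smul_mem' := by
    rintro a f ⟨h, hA, hh⟩
    refine ⟨a • h, A.smul_mem a hA, ?_⟩
    filter_upwards [hh, Lp.coeFn_smul a f, Lp.coeFn_smul a h] with x h1 h2 h3
    rw [h2, Pi.smul_apply, h1, h3, Pi.smul_apply, act, act, map_smul]

/-- The constant functions with values in `α ⊆ ℂⁿ`, as a subspace of `L²(S¹, ℂⁿ)`. -/
def constants {n : ℕ} (α : Submodule ℂ (Cn n)) : Submodule ℂ (L2 n) :=
  α.map (Lp.constₗ 2 circleMeasure ℂ)

/-- `W` is a shift-invariant subspace which is invariant under `f ↦ f_ω`. -/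
structure IsSymmetric {n : ℕ} (ω : Circle) (W : Submodule ℂ (L2 n)) : Prop where
  shift_mem : ∀ f ∈ W, shift n f ∈ W
  rot_mem : ∀ f ∈ W, rot n ω f ∈ W

/-- `W_j = {f ∈ W : f_ω = ω^j f}`. -/
def eigenpart {n : ℕ} (ω : Circle) (W : Submodule ℂ (L2 n)) (j : ℕ) : Submodule ℂ (L2 n) :=
  W ⊓ Module.End.eigenspace (rot n ω) ((ω : ℂ) ^ j)

/-- The map sending `f` to the function `λ ↦ λ^j f(λᵏ)`. -/
def twist (n k j : ℕ) [NeZero k] : L2 n →ₗ[ℂ] L2 n := (shift n ^ j) ∘ₗ powComp n k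

/-- The space `V_j` of all `f ∈ L²(S¹, ℂⁿ)` such that `λ ↦ λ^j f(λᵏ)` lies in `W_j`. -/
def filtrationPart {n : ℕ} (k : ℕ) [NeZero k] (ω : Circle) (W : Submodule ℂ (L2 n)) (j : ℕ) :
    Submodule ℂ (L2 n) :=
  (eigenpart ω W j).comap (twist n k j)

/-- The matrix of the orthogonal projection of `ℂⁿ` onto `α`. -/
def projMatrix {n : ℕ} (α : Submodule ℂ (Cn n)) : Mat n :=
  (Matrix.toEuclideanCLM (n := Fin n) (𝕜 := ℂ)).symm α.starProjection

/-- `β_j = ker (φ - ω^j I)`. -/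
def beta {n : ℕ} (ω : Circle) (φ : Mat n) (j : ℕ) : Submodule ℂ (Cn n) :=
  LinearMap.ker (Matrix.toEuclideanLin (φ - (ω : ℂ) ^ j • (1 : Mat n)))

/-- `α_j`, the sum of the `β_l` with `l ≤ j`. -/
def alpha {n : ℕ} (ω : Circle) (φ : Mat n) (j : ℕ) : Submodule ℂ (Cn n) :=
  ⨆ l ∈ Finset.range (j + 1), beta ω φ l

/-- `Φ_k(λ) = Φ(λ) ∑_{j<k} π_j λ^{-j}`, where `π_j` is the orthogonal projection onto `β_j`. -/
def untwist {n : ℕ} (k : ℕ) (ω : Circle) (φ : Mat n) (Φ : Circle → Mat n) (x : Circle) : Mat n :=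
  Φ x * ∑ j ∈ Finset.range k, ((x : ℂ) ^ j)⁻¹ • projMatrix (beta ω φ j)

/-- The pair `Ψ`, `(α_j)` represents the shift-invariant subspace `W` which is symmetric
under `f ↦ f_ω`, together with its filtration `V_0 ⊆ ⋯ ⊆ V_{k-1}`. Only `α_0, …, α_{k-2}` matter. -/
structure Represents {n : ℕ} (k : ℕ) [NeZero k] (ω : Circle) (W : Submodule ℂ (L2 n))
    (Ψ : Circle → Mat n) (α : ℕ → Submodule ℂ (Cn n)) : Prop where
  measurable : IsMeasurable Ψ
  /-- `Ψ` is unitary-valued almost everywhere. -/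
  unitary : ∀ᵐ x ∂circleMeasure, Ψ x ∈ Un n
  /-- `W_j = S^j {λ ↦ f(λᵏ) : f ∈ V_j}` for `0 ≤ j ≤ k - 1`. -/
  eigenpart_eq : ∀ j < k, eigenpart ω W j = (filtrationPart k ω W j).map (twist n k j)
  /-- `V_{k-1} = Ψ H₊`. -/
  top_eq : filtrationPart k ω W (k - 1) = mulImage Ψ (hardy n)
  /-- `α_0 ⊆ α_1 ⊆ ⋯ ⊆ α_{k-2}`. -/
  mono : ∀ i j, i ≤ j → j + 2 ≤ k → α i ≤ α j
  /-- `V_j = Ψ (π_{α_j} + λ π_{α_j}^⊥) H₊` for `0 ≤ j ≤ k - 2`. -/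
  part_eq_mul : ∀ j, j + 2 ≤ k → filtrationPart k ω W j =
    mulImage (fun x => Ψ x * (projMatrix (α j) + (x : ℂ) • projMatrix (α j)ᗮ)) (hardy n)
  /-- `V_j = Ψ (α_j + λ H₊)` for `0 ≤ j ≤ k - 2`. -/
  part_eq_add : ∀ j, j + 2 ≤ k → filtrationPart k ω W j =
    mulImage Ψ (constants (α j) ⊔ (hardy n).map (shift n))
  /-- `W = Ψ(λᵏ) (α_0 + λ α_1 + ⋯ + λ^{k-2} α_{k-2} + λ^{k-1} H₊)`. -/
  space_eq : W = mulImage (fun x => Ψ (x ^ k))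
    ((⨆ j ∈ Finset.range (k - 1), (constants (α j)).map (shift n ^ j)) ⊔
      (hardy n).map (shift n ^ (k - 1)))

section Smooth

open scoped Manifold ContDiff

variable {E : Type*} [NormedAddCommGroup E] [NormedSpace ℝ E] {H : Type*} [TopologicalSpace H]
  {M : Type*} [TopologicalSpace M] [ChartedSpace H M]

/-- A matrix-valued function on `S¹ × M` is smooth (all its entries are, over the reals). -/
def SmoothFamily {n : ℕ} (I : ModelWithCorners ℝ E H) (F : Circle → M → Mat n) : Prop :=
  ∀ a b : Fin n, ContMDiff ((𝓡 1).prod I) 𝓘(ℝ, ℂ) ∞ (fun p : Circle × M => F p.1 p.2 a b)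

/-- A family of subspaces of `ℂⁿ` is a smooth (complex) subbundle of `M × ℂⁿ`: near every point
there is a smooth frame. -/
def IsSmoothSubbundle {n : ℕ} (I : ModelWithCorners ℝ E H) (α : M → Submodule ℂ (Cn n)) : Prop :=
  ∀ z₀ : M, ∃ U : Set M, IsOpen U ∧ z₀ ∈ U ∧ ∃ (r : ℕ) (s : Fin r → M → Cn n),
    (∀ i (a : Fin n), ContMDiffOn I 𝓘(ℝ, ℂ) ∞ (fun z => s i z a) U) ∧
    ∀ z ∈ U, LinearIndependent ℂ (fun i => s i z) ∧
      Submodule.span ℂ (Set.range fun i => s i z) = α z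

end Smooth

end

end KSymmetric

open KSymmetric

namespace KSymmetric

open Filter

/-! ### Matrix multipliers acting on square-integrable functions. -/

section Action

variable {n : ℕ}

/-! Rotation by `ω` has finite order, so it maps `W = ΦH₊` onto itself, and it maps `H₊` onto
itself. Hence `U(λ) = Φ(λ)* Φ(ωλ)` and `U*` both preserve `H₊`. For constant `v` the function `Uv`
then has no negative Fourier coefficients and, by duality with `U*`, no positive ones, so `U` is a
constant `φ` (`exists_const_of_mulImage_hardy_le`, `exists_monodromy`). Going once around the orbit
of `ω` gives `φ^k = 1`.

The spectral projections `P_j` of `φ` are averages of powers of `φ`. The unitary polynomial `L(λ) =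
∑ λ^j P_j` satisfies `L(ωλ) = φ L(λ)`, so `Φ L*` is invariant under rotation by `ω` and equals
`Ψ(λᵏ)`. Thus `W = Ψ(λᵏ) L H₊`. The `P_j`-component of an element of `L H₊` starts in degree `j`, so
`L H₊` consists of the `g ∈ H₊` whose `i`-th coefficient lies in `α_i` for `i ≤ k - 2`
(`mulImage_laurent`); peeling off coefficients gives the sum formula for `W`
(`constrainedHardy_eq`).

The map `f ↦ λ^j f(λᵏ)` puts the coefficients of `f` in the degrees `j + kℤ` and turns
multiplication by `Ψ` into multiplication by `Ψ(λᵏ)`. So `V_j` is `Ψ` times the functions in `H₊`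
with zeroth coefficient in `α_j`, with no condition when `j = k - 1` (`filtrationPart_eq`). The case
of two projections rewrites this in both required forms.

In the smooth case `φ(z) = Φ(ω, z)`, so the `P_j` are smooth. Local smooth roots make `Ψ` smooth,
and partial sums of the `P_j` are smooth idempotents with ranges `α_j`. -/

theorem act_mul (A B : Mat n) (v : Cn n) : act (A * B) v = act A (act B v) := by
  simp [act]

theorem act_one (v : Cn n) : act (1 : Mat n) v = v := by
  simp [act]

theorem act_add_left (A B : Mat n) (v : Cn n) : act (A + B) v = act A v + act B v := by
  simp [act]

theorem act_smul_left (c : ℂ) (A : Mat n) (v : Cn n) : act (c • A) v = c • act A v := by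
  simp [act]

theorem act_sum_left {ι : Type*} (s : Finset ι) (A : ι → Mat n) (v : Cn n) :
    act (∑ i ∈ s, A i) v = ∑ i ∈ s, act (A i) v := by
  simp [act]

theorem act_zero_left (v : Cn n) : act (0 : Mat n) v = 0 := by
  simp [act]

theorem act_zero (A : Mat n) : act A (0 : Cn n) = 0 := by
  simp [act]

theorem act_smul (A : Mat n) (c : ℂ) (v : Cn n) : act A (c • v) = c • act A v := by
  simp [act]

theorem act_apply (A : Mat n) (v : Cn n) (a : Fin n) : act A v a = ∑ b, A a b * v b := by
  simp [act, Matrix.mulVec, dotProduct]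

theorem act_single (A : Mat n) (a b : Fin n) : act A (EuclideanSpace.single b 1) a = A a b := by
  simp [act_apply]

theorem ext_act {A B : Mat n} (h : ∀ v, act A v = act B v) : A = B := by
  refine Matrix.ext fun a b => ?_
  rw [← act_single A, ← act_single B, h]

theorem star_mul_self_of_mem {A : Mat n} (hA : A ∈ Un n) : star A * A = 1 :=
  Unitary.star_mul_self_of_mem hA

theorem mul_star_self_of_mem {A : Mat n} (hA : A ∈ Un n) : A * star A = 1 :=
  Unitary.mul_star_self_of_mem hA

theorem star_mem_Un {A : Mat n} (hA : A ∈ Un n) : star A ∈ Un n :=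
  Unitary.star_mem hA

theorem act_star_act {A : Mat n} (hA : A ∈ Un n) (v : Cn n) : act (star A) (act A v) = v := by
  rw [← act_mul, star_mul_self_of_mem hA, act_one]

theorem act_act_star {A : Mat n} (hA : A ∈ Un n) (v : Cn n) : act A (act (star A) v) = v := by
  rw [← act_mul, mul_star_self_of_mem hA, act_one]

theorem norm_act {A : Mat n} (hA : A ∈ Un n) (v : Cn n) : ‖act A v‖ = ‖v‖ := by
  have h : Matrix.toEuclideanCLM (𝕜 := ℂ) A ∈ unitary (Cn n →L[ℂ] Cn n) :=
    Unitary.map_mem (Matrix.toEuclideanCLM (n := Fin n) (𝕜 := ℂ)) hA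
  exact Unitary.norm_map ⟨_, h⟩ v

theorem IsMeasurable.mul {F G : Circle → Mat n} (hF : IsMeasurable F) (hG : IsMeasurable G) :
    IsMeasurable fun x => F x * G x := fun a b => by
  simp only [Matrix.mul_apply]
  exact Finset.aemeasurable_fun_sum _ fun i _ => (hF a i).mul (hG i b)

theorem IsMeasurable.star {F : Circle → Mat n} (hF : IsMeasurable F) :
    IsMeasurable fun x => star (F x) := fun a b => by
  simp only [Matrix.star_apply]
  exact Complex.continuous_conj.measurable.comp_aemeasurable (hF b a)

theorem IsMeasurable.comp {F : Circle → Mat n} (hF : IsMeasurable F) {g : Circle → Circle}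
    (hg : MeasurePreserving g circleMeasure circleMeasure) : IsMeasurable fun x => F (g x) :=
  fun a b => (hF a b).comp_quasiMeasurePreserving hg.quasiMeasurePreserving

theorem IsMeasurable.congr {F G : Circle → Mat n} (hF : IsMeasurable F)
    (h : ∀ᵐ x ∂circleMeasure, F x = G x) : IsMeasurable G := fun a b =>
  (hF a b).congr (h.mono fun x hx => by simp only [hx])

theorem isMeasurable_of_continuous {F : Circle → Mat n} (h : ∀ a b, Continuous fun x => F x a b) :
    IsMeasurable F := fun a b => (h a b).measurable.aemeasurable

theorem aestronglyMeasurable_act {F : Circle → Mat n} (hF : IsMeasurable F) {h : Circle → Cn n}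
    (hh : AEStronglyMeasurable h circleMeasure) :
    AEStronglyMeasurable (fun x => act (F x) (h x)) circleMeasure := by
  have h1 : AEMeasurable (fun x => fun a => ∑ b, F x a b * h x b) circleMeasure :=
    aemeasurable_pi_iff.2 fun a => Finset.aemeasurable_fun_sum _ fun b _ => (hF a b).mul
      ((EuclideanSpace.proj (𝕜 := ℂ) b).continuous.measurable.comp_aemeasurable hh.aemeasurable)
  have h2 := ((WithLp.measurable_toLp 2 (Fin n → ℂ)).comp_aemeasurable h1).aestronglyMeasurable
  refine h2.congr (Eventually.of_forall fun x => ?_)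
  ext a
  simp [act_apply]

/-- Multiplication by a measurable unitary-valued function preserves `L²`. -/
theorem exists_coeFn_eq_act {F : Circle → Mat n} (hF : IsMeasurable F)
    (hU : ∀ᵐ x ∂circleMeasure, F x ∈ Un n) (h : L2 n) :
    ∃ g : L2 n, ∀ᵐ x ∂circleMeasure, g x = act (F x) (h x) := by
  have hm : MemLp (fun x => act (F x) (h x)) 2 circleMeasure :=
    (Lp.memLp h).of_le (aestronglyMeasurable_act hF (Lp.aestronglyMeasurable h))
      (hU.mono fun x hx => (norm_act hx _).le)
  exact ⟨hm.toLp _, hm.coeFn_toLp⟩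

theorem mem_mulImage {F : Circle → Mat n} {A : Submodule ℂ (L2 n)} {f : L2 n} :
    f ∈ mulImage F A ↔ ∃ h ∈ A, ∀ᵐ x ∂circleMeasure, f x = act (F x) (h x) := Iff.rfl

theorem mulImage_congr {F G : Circle → Mat n} (h : ∀ᵐ x ∂circleMeasure, F x = G x)
    (A : Submodule ℂ (L2 n)) : mulImage F A = mulImage G A := by
  ext f
  simp only [mem_mulImage]
  refine exists_congr fun g => and_congr_right fun _ => ?_
  exact eventually_congr (h.mono fun x hx => by rw [hx])

/-- Unitarity of `G` keeps the intermediate product `G h` in `L²`; without it the right side could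
lose elements. -/
theorem mulImage_mul {F G : Circle → Mat n} (hG : IsMeasurable G)
    (hU : ∀ᵐ x ∂circleMeasure, G x ∈ Un n) (A : Submodule ℂ (L2 n)) :
    mulImage (fun x => F x * G x) A = mulImage F (mulImage G A) := by
  ext f
  simp only [mem_mulImage]
  constructor
  · rintro ⟨h, hA, hf⟩
    obtain ⟨g, hg⟩ := exists_coeFn_eq_act hG hU h
    refine ⟨g, ⟨h, hA, hg⟩, ?_⟩
    filter_upwards [hf, hg] with x h1 h2
    rw [h1, h2, act_mul]
  · rintro ⟨g, ⟨h, hA, hg⟩, hf⟩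
    refine ⟨h, hA, ?_⟩
    filter_upwards [hf, hg] with x h1 h2
    rw [h1, h2, act_mul]

/-- Membership in `F A` can be tested on any preimage when `F` is unitary-valued. -/
theorem mem_mulImage_iff_of_eq {F : Circle → Mat n} (hU : ∀ᵐ x ∂circleMeasure, F x ∈ Un n)
    {A : Submodule ℂ (L2 n)} {f h : L2 n} (hf : ∀ᵐ x ∂circleMeasure, f x = act (F x) (h x)) :
    f ∈ mulImage F A ↔ h ∈ A := by
  constructor
  · rintro ⟨g, hA, hg⟩
    have : h = g := by
      refine Lp.ext ?_
      filter_upwards [hU, hf, hg] with x h1 h2 h3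
      rw [← act_star_act h1 (h x), ← h2, h3, act_star_act h1]
    rwa [this]
  · exact fun hA => ⟨h, hA, hf⟩

theorem exists_preimage_act {F : Circle → Mat n} (hF : IsMeasurable F)
    (hU : ∀ᵐ x ∂circleMeasure, F x ∈ Un n) (f : L2 n) :
    ∃ h : L2 n, ∀ᵐ x ∂circleMeasure, f x = act (F x) (h x) := by
  obtain ⟨h, hh⟩ := exists_coeFn_eq_act hF.star (hU.mono fun x hx => star_mem_Un hx) f
  refine ⟨h, ?_⟩
  filter_upwards [hh, hU] with x h1 h2
  rw [h1, act_act_star h2]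

end Action

/-! ### Fourier coefficients under shifts, rotations and twists. -/

section Coefficients

variable {n : ℕ}

theorem coeFn_shift (f : L2 n) : ∀ᵐ x ∂circleMeasure, shift n f x = (x : ℂ) • f x :=
  (memLp_smul continuous_id f).coeFn_toLp

theorem coeFn_shift_pow (j : ℕ) (f : L2 n) :
    ∀ᵐ x ∂circleMeasure, (shift n ^ j) f x = ((x ^ j : Circle) : ℂ) • f x := by
  induction j with
  | zero => exact Eventually.of_forall fun x => by simp
  | succ j ih =>
    rw [pow_succ', Module.End.mul_apply]
    filter_upwards [ih, coeFn_shift ((shift n ^ j) f)] with x h1 h2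
    rw [h2, h1, smul_smul, pow_succ']
    simp

theorem coeFn_rot (ω : Circle) (f : L2 n) : ∀ᵐ x ∂circleMeasure, rot n ω f x = f (ω * x) :=
  Lp.coeFn_compMeasurePreserving f (measurePreserving_mul_left circleMeasure ω)

theorem coeFn_powComp (k : ℕ) [NeZero k] (f : L2 n) :
    ∀ᵐ x ∂circleMeasure, powComp n k f x = f (x ^ k) :=
  Lp.coeFn_compMeasurePreserving f (measurePreserving_pow k)

theorem coeFn_twist (k j : ℕ) [NeZero k] (f : L2 n) :
    ∀ᵐ x ∂circleMeasure, twist n k j f x = ((x ^ j : Circle) : ℂ) • f (x ^ k) := by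
  filter_upwards [coeFn_shift_pow j (powComp n k f), coeFn_powComp k f] with x h1 h2
  rw [twist, LinearMap.comp_apply, h1, h2]

theorem coefficient_congr {f : L2 n} {g : Circle → Cn n} (h : ∀ᵐ x ∂circleMeasure, f x = g x)
    (m : ℤ) : fourierCoefficient f m = ∫ x : Circle, ((x ^ (-m) : Circle) : ℂ) • g x ∂circleMeasure :=
  integral_congr_ae (h.mono fun x hx => by simp only [hx])

theorem coefficient_add (f g : L2 n) (m : ℤ) :
    fourierCoefficient (f + g) m = fourierCoefficient f m + fourierCoefficient g m := by
  rw [coefficient_congr (Lp.coeFn_add f g), fourierCoefficient, fourierCoefficient,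
    ← integral_add (integrable_smul f m) (integrable_smul g m)]
  simp only [Pi.add_apply, smul_add]

theorem coefficient_smul (a : ℂ) (f : L2 n) (m : ℤ) :
    fourierCoefficient (a • f) m = a • fourierCoefficient f m := by
  rw [coefficient_congr (Lp.coeFn_smul a f), fourierCoefficient, ← integral_smul]
  simp only [Pi.smul_apply, smul_comm a]

/-- The Fourier coefficient as a linear map. -/
noncomputable def coefficientₗ (n : ℕ) (m : ℤ) : L2 n →ₗ[ℂ] Cn n where
  toFun f := fourierCoefficient f m
  map_add' f g := coefficient_add f g m
  map_smul' a f := coefficient_smul a f m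

theorem coefficientₗ_apply (m : ℤ) (f : L2 n) : coefficientₗ n m f = fourierCoefficient f m := rfl

theorem mem_hardy {f : L2 n} : f ∈ hardy n ↔ ∀ m : ℤ, m < 0 → fourierCoefficient f m = 0 := Iff.rfl

/-- Multiplying by `λ^j A`, for a constant matrix `A`, shifts the Fourier coefficients. -/
theorem integral_smul_act (f : L2 n) (A : Mat n) (j m : ℤ) :
    ∫ x : Circle, ((x ^ (-m) : Circle) : ℂ) • ((x ^ j : Circle) : ℂ) • act A (f x) ∂circleMeasure
      = act A (fourierCoefficient f (m - j)) := by
  rw [fourierCoefficient, act, ← ContinuousLinearMap.integral_comp_comm _ (integrable_smul f (m - j))]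
  refine integral_congr_ae (Eventually.of_forall fun x => ?_)
  simp only [map_smul, act, smul_smul]
  congr 1
  rw [← Circle.coe_mul, ← zpow_add]
  congr 2
  ring

theorem integrable_smul_act (f : L2 n) (A : Mat n) (j m : ℤ) :
    Integrable (fun x : Circle => ((x ^ (-m) : Circle) : ℂ) • ((x ^ j : Circle) : ℂ) • act A (f x))
      circleMeasure := by
  have h := (Matrix.toEuclideanCLM (𝕜 := ℂ) A).integrable_comp (integrable_smul f (m - j))
  refine h.congr (Eventually.of_forall fun x => ?_)
  simp only [map_smul, act, smul_smul]
  congr 1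
  rw [← Circle.coe_mul, ← zpow_add]
  congr 2
  ring

/-- Fourier coefficients of the product with a matrix-valued Laurent polynomial. -/
theorem coefficient_of_coeFn_eq_sum {f g : L2 n} {ι : Type*} (s : Finset ι) (e : ι → ℤ)
    (A : ι → Mat n)
    (h : ∀ᵐ x ∂circleMeasure, g x = ∑ i ∈ s, ((x ^ e i : Circle) : ℂ) • act (A i) (f x)) (m : ℤ) :
    fourierCoefficient g m = ∑ i ∈ s, act (A i) (fourierCoefficient f (m - e i)) := by
  rw [coefficient_congr h]
  simp only [Finset.smul_sum]
  rw [integral_finsetSum _ fun i _ => integrable_smul_act f (A i) (e i) m]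
  simp only [integral_smul_act]

theorem coefficient_shift_pow (f : L2 n) (j : ℕ) (m : ℤ) :
    fourierCoefficient ((shift n ^ j) f) m = fourierCoefficient f (m - j) := by
  rw [coefficient_congr (coeFn_shift_pow j f)]
  simpa [act_one] using integral_smul_act f 1 j m

theorem exists_zpow_ne_one {m : ℤ} (hm : m ≠ 0) : ∃ y : Circle, y ^ m ≠ 1 := by
  -- The `m`-th power of this point is `-1`.
  refine ⟨Circle.exp (Real.pi / m), fun h => ?_⟩
  rw [← Circle.exp_zsmul, zsmul_eq_mul, mul_div_cancel₀ _ (Int.cast_ne_zero.2 hm)] at h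
  have := congrArg (fun z : Circle => (z : ℂ)) h
  simp at this
  norm_num [Complex.ext_iff] at this

/-- A function which picks up a factor `c ≠ 1` under a rotation has integral zero. -/
theorem integral_eq_zero_of_rotation {g : Circle → Cn n} {y : Circle} {c : ℂ} (hc : c ≠ 1)
    (h : ∀ᵐ x ∂circleMeasure, g (y * x) = c • g x) : ∫ x, g x ∂circleMeasure = 0 := by
  have h1 : ∫ x, g x ∂circleMeasure = c • ∫ x, g x ∂circleMeasure := by
    conv_lhs => rw [← integral_mul_left_eq_self g y]
    rw [integral_congr_ae h, integral_smul]
  have h2 : (1 - c) • ∫ x, g x ∂circleMeasure = 0 := by rw [sub_smul, one_smul, ← h1, sub_self]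
  exact (smul_eq_zero.1 h2).resolve_left (sub_ne_zero.2 hc.symm)

theorem integral_zpow_smul_const (m : ℤ) (c : Cn n) :
    ∫ x : Circle, ((x ^ (-m) : Circle) : ℂ) • c ∂circleMeasure = if m = 0 then c else 0 := by
  split_ifs with h
  · subst h; simp
  · obtain ⟨y, hy⟩ := exists_zpow_ne_one (neg_ne_zero.2 h)
    refine integral_eq_zero_of_rotation (y := y) (c := ((y ^ (-m) : Circle) : ℂ)) ?_ ?_
    · rwa [Ne, Circle.coe_eq_one]
    · exact Eventually.of_forall fun x => by
        simp only [mul_zpow, Circle.coe_mul, smul_smul]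

theorem coeFn_constₗ (c : Cn n) :
    ∀ᵐ x ∂circleMeasure, Lp.constₗ 2 circleMeasure ℂ c x = c :=
  Lp.coeFn_const ..

theorem coefficient_const (c : Cn n) (m : ℤ) :
    fourierCoefficient (Lp.constₗ 2 circleMeasure ℂ c) m = if m = 0 then c else 0 := by
  rw [coefficient_congr (coeFn_constₗ c), integral_zpow_smul_const]

/-- Change of variables along the measure-preserving map `λ ↦ λᵏ`. Together with
`coefficient_twist_eq_zero` this determines every coefficient of a twist. -/
theorem coefficient_twist_mul (k j : ℕ) [NeZero k] (f : L2 n) (m : ℤ) :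
    fourierCoefficient (twist n k j f) (j + k * m) = fourierCoefficient f m := by
  rw [coefficient_congr (coeFn_twist k j f)]
  have h := integral_map (μ := circleMeasure) (measurePreserving_pow k).aemeasurable
    (f := fun x : Circle => ((x ^ (-m) : Circle) : ℂ) • f x)
    (by rw [(measurePreserving_pow k).map_eq]; exact (integrable_smul f m).aestronglyMeasurable)
  rw [(measurePreserving_pow k).map_eq] at h
  rw [fourierCoefficient, h]
  refine integral_congr_ae (Eventually.of_forall fun x => ?_)
  simp only [smul_smul, ← Circle.coe_mul]
  congr 2
  rw [← zpow_natCast, ← zpow_natCast, ← zpow_add, ← zpow_mul]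
  congr 1
  ring

/-- Rotating by `ω` multiplies the integrand by `ω^(j - m)`, which is not `1` by primitivity. -/
theorem coefficient_twist_eq_zero {k : ℕ} [NeZero k] {ω : Circle} (hω : IsPrimitiveRoot ω k) (j : ℕ)
    (f : L2 n) {m : ℤ} (hm : ¬ (k : ℤ) ∣ m - j) : fourierCoefficient (twist n k j f) m = 0 := by
  rw [coefficient_congr (coeFn_twist k j f)]
  refine integral_eq_zero_of_rotation (y := ω) (c := ((ω ^ (-(m - j)) : Circle) : ℂ)) ?_ ?_
  · rw [Ne, Circle.coe_eq_one, hω.zpow_eq_one_iff_dvd, dvd_neg]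
    exact hm
  · refine Eventually.of_forall fun x => ?_
    simp only [mul_pow, hω.pow_eq_one, one_mul, mul_zpow, smul_smul, ← Circle.coe_mul]
    congr 2
    rw [neg_sub, zpow_sub, zpow_neg, zpow_natCast]
    ac_rfl

end Coefficients

end KSymmetric

namespace KSymmetric

open Filter

/-! ### Completeness of the characters in `L²`. -/

section Uniqueness

/-- The character `λ ↦ λ^m` of the circle. -/
noncomputable def character (m : ℤ) : C(Circle, ℂ) where
  toFun x := ((x ^ m : Circle) : ℂ)
  continuous_toFun := continuous_subtype_val.comp (continuous_zpow m)

theorem character_apply (m : ℤ) (x : Circle) : character m x = ((x ^ m : Circle) : ℂ) := rfl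

/-- The star subalgebra of `C(S¹, ℂ)` generated by the characters. -/
noncomputable def characterSubalgebra : StarSubalgebra ℂ C(Circle, ℂ) where
  toSubalgebra := Algebra.adjoin ℂ (Set.range character)
  star_mem' := by
    change Algebra.adjoin ℂ (Set.range character) ≤ star (Algebra.adjoin ℂ (Set.range character))
    refine Algebra.adjoin_le ?_
    rintro - ⟨m, rfl⟩
    refine Algebra.subset_adjoin ⟨-m, ContinuousMap.ext fun x => ?_⟩
    simp [character_apply, ← Circle.coe_inv_eq_conj, zpow_neg]

/-- Products of characters are characters, so the generated algebra is already their linear span;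
Stone–Weierstrass then yields density of the span. -/
theorem characterSubalgebra_coe :
    Subalgebra.toSubmodule characterSubalgebra.toSubalgebra
      = Submodule.span ℂ (Set.range character) := by
  apply Algebra.adjoin_eq_span_of_subset
  refine Set.Subset.trans ?_ Submodule.subset_span
  intro x hx
  refine Submonoid.closure_induction (fun _ => id) ⟨0, ?_⟩ ?_ hx
  · ext1 z; simp [character_apply]
  · rintro - - - - ⟨m, rfl⟩ ⟨l, rfl⟩
    refine ⟨m + l, ?_⟩
    ext1 z
    simp only [character_apply, ContinuousMap.mul_apply, zpow_add, Circle.coe_mul]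

theorem characterSubalgebra_closure_eq_top : characterSubalgebra.topologicalClosure = ⊤ := by
  refine ContinuousMap.starSubalgebra_topologicalClosure_eq_top_of_separatesPoints _ ?_
  intro x y hxy
  refine ⟨_, ⟨character 1, Algebra.subset_adjoin ⟨1, rfl⟩, rfl⟩, ?_⟩
  simpa [character_apply, Circle.ext_iff] using hxy

theorem span_character_closure_eq_top :
    (Submodule.span ℂ (Set.range character)).topologicalClosure = ⊤ := by
  rw [← characterSubalgebra_coe]
  exact congr_arg (Subalgebra.toSubmodule <| StarSubalgebra.toSubalgebra ·)
    characterSubalgebra_closure_eq_top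

/-- A scalar `L²` function on the circle with vanishing Fourier coefficients is zero. -/
theorem eq_zero_of_forall_integral_eq_zero (F : Lp ℂ 2 circleMeasure)
    (h : ∀ m : ℤ, ∫ x : Circle, ((x ^ (-m) : Circle) : ℂ) * F x ∂circleMeasure = 0) : F = 0 := by
  -- Pairing with `F`, restricted to continuous functions: it kills the characters, hence all of
  -- `C(S¹)`, which is dense in `L²`.
  let T : C(Circle, ℂ) →L[ℂ] ℂ := (innerSL ℂ F).comp (ContinuousMap.toLp 2 circleMeasure ℂ)
  have hT : ∀ m, T (character m) = 0 := by
    intro m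
    have h1 : T (character m) = ∫ x : Circle, (starRingEnd ℂ)
        (((x ^ (-m) : Circle) : ℂ) * F x) ∂circleMeasure := by
      change inner ℂ F (ContinuousMap.toLp 2 circleMeasure ℂ (character m)) = _
      rw [L2.inner_def]
      refine integral_congr_ae ?_
      filter_upwards [ContinuousMap.coeFn_toLp (p := 2) (𝕜 := ℂ) circleMeasure (character m)]
        with x hx
      rw [hx]
      simp [character_apply, zpow_neg, ← Circle.coe_inv_eq_conj]
    rw [h1, integral_conj, h m, map_zero]
  have hker : T.ker = ⊤ := by
    rw [eq_top_iff, ← span_character_closure_eq_top]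
    refine Submodule.topologicalClosure_minimal _ ?_ T.isClosed_ker
    rw [Submodule.span_le]
    rintro - ⟨m, rfl⟩
    exact hT m
  refine (ContinuousMap.toLp_denseRange ℂ circleMeasure ℂ (p := 2)
    ENNReal.ofNat_ne_top).eq_zero_of_inner_left ℂ ?_
  intro g
  have : g ∈ T.ker := hker ▸ Submodule.mem_top
  exact this

variable {n : ℕ}

theorem eq_zero_of_coefficient_eq_zero (f : L2 n) (h : ∀ m, fourierCoefficient f m = 0) :
    f = 0 := by
  have key : ∀ a : Fin n, ∀ᵐ x ∂circleMeasure, f x a = 0 := by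
    intro a
    let L : Cn n →L[ℂ] ℂ := EuclideanSpace.proj a
    have h1 : L.compLp f = 0 := by
      refine eq_zero_of_forall_integral_eq_zero _ fun m => ?_
      have h2 : ∫ x : Circle, L (((x ^ (-m) : Circle) : ℂ) • f x) ∂circleMeasure = 0 := by
        rw [L.integral_comp_comm (integrable_smul f m)]
        change L (fourierCoefficient f m) = 0
        rw [h, map_zero]
      rw [← h2]
      refine integral_congr_ae ?_
      filter_upwards [L.coeFn_compLp f] with x hx
      rw [hx, map_smul, smul_eq_mul]
    filter_upwards [L.coeFn_compLp f, Lp.coeFn_zero ℂ 2 circleMeasure] with x h3 h4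
    rw [h1, h4] at h3
    exact h3.symm
  refine Lp.ext ?_
  filter_upwards [ae_all_iff.2 key, Lp.coeFn_zero (Cn n) 2 circleMeasure] with x h1 h2
  rw [h2]
  ext a
  exact h1 a

/-- A function whose nonzero Fourier coefficients vanish is constant. -/
theorem coeFn_eq_of_coefficient_eq_zero (f : L2 n)
    (h : ∀ m, m ≠ 0 → fourierCoefficient f m = 0) :
    ∀ᵐ x ∂circleMeasure, f x = fourierCoefficient f 0 := by
  have h1 : f = Lp.constₗ 2 circleMeasure ℂ (fourierCoefficient f 0) := by
    rw [← sub_eq_zero]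
    refine eq_zero_of_coefficient_eq_zero _ fun m => ?_
    rw [← coefficientₗ_apply, map_sub, coefficientₗ_apply, coefficientₗ_apply, coefficient_const]
    split_ifs with hm
    · rw [hm, sub_self]
    · rw [h m hm, sub_self]
  conv => enter [1, x, 1]; rw [h1]
  exact coeFn_constₗ _

end Uniqueness

/-! ### Rigidity of multipliers and the monodromy matrix. -/

section Constancy

variable {n : ℕ}

theorem const_mem_hardy (c : Cn n) : Lp.constₗ 2 circleMeasure ℂ c ∈ hardy n := fun m hm => by
  rw [coefficient_const, if_neg hm.ne]

theorem inner_act (A : Mat n) (v w : Cn n) : inner ℂ w (act A v) = inner ℂ (act (star A) w) v := by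
  have : act (star A) w = ContinuousLinearMap.adjoint (Matrix.toEuclideanCLM (𝕜 := ℂ) A) w := by
    rw [act, map_star]; rfl
  rw [this, ContinuousLinearMap.adjoint_inner_left]
  rfl

/-- A unitary-valued multiplier which preserves the Hardy space together with its inverse is
constant. -/
theorem exists_const_of_mulImage_hardy_le {U : Circle → Mat n} (hm : IsMeasurable U)
    (hU : ∀ᵐ x ∂circleMeasure, U x ∈ Un n) (h1 : mulImage U (hardy n) ≤ hardy n)
    (h2 : mulImage (fun x => star (U x)) (hardy n) ≤ hardy n) :
    ∃ φ ∈ Un n, ∀ᵐ x ∂circleMeasure, U x = φ := by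
  have key : ∀ v : Cn n, ∃ c : Cn n, ∀ᵐ x ∂circleMeasure, act (U x) v = c := by
    intro v
    obtain ⟨g, hg⟩ := exists_coeFn_eq_act hm hU (Lp.constₗ 2 circleMeasure ℂ v)
    have hgH : g ∈ hardy n := h1 ⟨_, const_mem_hardy v, hg⟩
    have hgv : ∀ᵐ x ∂circleMeasure, g x = act (U x) v := by
      filter_upwards [hg, coeFn_constₗ v] with x h3 h4
      rw [h3, h4]
    refine ⟨fourierCoefficient g 0, ?_⟩
    have hc := coeFn_eq_of_coefficient_eq_zero g fun m hm0 => ?_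
    · filter_upwards [hc, hgv] with x h3 h4
      rw [← h4, h3]
    rcases lt_or_gt_of_ne hm0 with hlt | hgt
    · exact hgH m hlt
    -- Positive coefficients: `⟨w, Uv⟩` is the conjugate of `⟨v, U*w⟩`, so degree `m` of `Uv` is
    -- tied to degree `-m` of `U*w`, and `U*w` lies in `H₊`.
    refine ext_inner_left ℂ fun w => ?_
    obtain ⟨g', hg'⟩ := exists_coeFn_eq_act hm.star (hU.mono fun x hx => star_mem_Un hx)
      (Lp.constₗ 2 circleMeasure ℂ w)
    have hgH' : g' ∈ hardy n := h2 ⟨_, const_mem_hardy w, hg'⟩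
    have hgw : ∀ᵐ x ∂circleMeasure, g' x = act (star (U x)) w := by
      filter_upwards [hg', coeFn_constₗ w] with x h3 h4
      rw [h3, h4]
    have h5 : inner ℂ w (fourierCoefficient g m)
        = (starRingEnd ℂ) (inner ℂ v (fourierCoefficient g' (-m))) := by
      rw [fourierCoefficient, fourierCoefficient, ← integral_inner (integrable_smul g m),
        ← integral_inner (integrable_smul g' (-m)), ← integral_conj]
      refine integral_congr_ae ?_
      filter_upwards [hgv, hgw] with x h6 h7
      rw [h6, h7, inner_smul_right, inner_smul_right, inner_act, map_mul, inner_conj_symm,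
        ← Circle.coe_inv_eq_conj]
      simp
    rw [h5, hgH' _ (neg_lt_zero.2 hgt), inner_zero_right, inner_zero_right, map_zero]
  choose c hc using key
  let φ : Mat n := Matrix.of fun a b => c (EuclideanSpace.single b 1) a
  have hφ : ∀ᵐ x ∂circleMeasure, U x = φ := by
    have := ae_all_iff.2 fun b : Fin n => hc (EuclideanSpace.single b 1)
    filter_upwards [this] with x hx
    refine Matrix.ext fun a b => ?_
    rw [← act_single (U x), hx b]
    rfl
  obtain ⟨x, hx1, hx2⟩ := (hφ.and hU).exists
  exact ⟨φ, hx1 ▸ hx2, hφ⟩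

theorem ae_rotate {p : Circle → Prop} (h : ∀ᵐ x ∂circleMeasure, p x) (y : Circle) :
    ∀ᵐ x ∂circleMeasure, p (y * x) :=
  (measurePreserving_mul_left circleMeasure y).quasiMeasurePreserving.ae h

theorem rot_rot (y z : Circle) (f : L2 n) : rot n y (rot n z f) = rot n (z * y) f := by
  refine Lp.ext ?_
  filter_upwards [coeFn_rot y (rot n z f), ae_rotate (coeFn_rot z f) y, coeFn_rot (z * y) f]
    with x h1 h2 h3
  rw [h1, h2, h3, mul_assoc]

theorem rot_one (f : L2 n) : rot n 1 f = f := by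
  refine Lp.ext ?_
  filter_upwards [coeFn_rot 1 f] with x h1
  rw [h1, one_mul]

theorem coefficient_rot (y : Circle) (f : L2 n) (m : ℤ) :
    fourierCoefficient (rot n y f) m = ((y ^ m : Circle) : ℂ) • fourierCoefficient f m := by
  rw [coefficient_congr (coeFn_rot y f), fourierCoefficient, ← integral_smul,
    ← integral_mul_left_eq_self (fun x => ((y ^ m : Circle) : ℂ) • _) y]
  refine integral_congr_ae (Eventually.of_forall fun x => ?_)
  simp only [smul_smul, ← Circle.coe_mul]
  congr 2
  rw [mul_zpow, ← mul_assoc, ← zpow_add, add_neg_cancel, zpow_zero, one_mul]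

theorem rot_mem_hardy {f : L2 n} (hf : f ∈ hardy n) (y : Circle) : rot n y f ∈ hardy n :=
  fun m hm => by rw [coefficient_rot, hf m hm, smul_zero]

theorem IsSymmetric.rot_pow_mem {ω : Circle} {W : Submodule ℂ (L2 n)} (hW : IsSymmetric ω W)
    {f : L2 n} (hf : f ∈ W) (j : ℕ) : rot n (ω ^ j) f ∈ W := by
  induction j with
  | zero => rwa [pow_zero, rot_one]
  | succ j ih =>
    rw [pow_succ, ← rot_rot]
    exact hW.rot_mem _ ih

theorem IsSymmetric.rot_inv_mem {k : ℕ} [NeZero k] {ω : Circle} {W : Submodule ℂ (L2 n)}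
    (hW : IsSymmetric ω W) (hω : ω ^ k = 1) {f : L2 n} (hf : f ∈ W) : rot n ω⁻¹ f ∈ W := by
  have h : ω⁻¹ = ω ^ (k - 1) := by
    rw [inv_eq_iff_mul_eq_one, ← pow_succ', Nat.sub_add_cancel (NeZero.pos k), hω]
  rw [h]
  exact hW.rot_pow_mem hf _

/-- A symmetric space `Φ H₊` has a constant monodromy matrix. -/
theorem exists_monodromy {k : ℕ} [NeZero k] {ω : Circle} (hω : ω ^ k = 1)
    {W : Submodule ℂ (L2 n)} {Φ : Circle → Mat n} (hW : IsSymmetric ω W) (hm : IsMeasurable Φ)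
    (hU : ∀ᵐ x ∂circleMeasure, Φ x ∈ Un n) (hWΦ : W = mulImage Φ (hardy n)) :
    ∃ φ ∈ Un n, ∀ᵐ x ∂circleMeasure, Φ (ω * x) = Φ x * φ := by
  have hUω := ae_rotate hU ω
  have hUmem : ∀ᵐ x ∂circleMeasure, star (Φ x) * Φ (ω * x) ∈ Un n := by
    filter_upwards [hU, hUω] with x h1 h2
    exact mul_mem (star_mem_Un h1) h2
  have hUm : IsMeasurable fun x => star (Φ x) * Φ (ω * x) :=
    hm.star.mul (hm.comp (measurePreserving_mul_left circleMeasure ω))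
  have h1 : mulImage (fun x => star (Φ x) * Φ (ω * x)) (hardy n) ≤ hardy n := by
    rintro g ⟨h, hh, hg⟩
    -- Undoing the rotation on `h` first makes the rotated `f` equal to `Φ(ωλ) h(λ) = Φ(λ) g(λ)`.
    obtain ⟨f, hf⟩ := exists_coeFn_eq_act hm hU (rot n ω⁻¹ h)
    have hfW : rot n ω f ∈ W := hW.rot_mem _ (hWΦ ▸ ⟨_, rot_mem_hardy hh _, hf⟩)
    rw [hWΦ, mem_mulImage_iff_of_eq hU (h := g)] at hfW
    · exact hfW
    filter_upwards [coeFn_rot ω f, ae_rotate hf ω, ae_rotate (coeFn_rot ω⁻¹ h) ω, hg, hU]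
      with x h1 h2 h3 h4 h5
    rw [h1, h2, h3, h4, act_mul, act_act_star h5, inv_mul_cancel_left]
  have h2 : mulImage (fun x => star (star (Φ x) * Φ (ω * x))) (hardy n) ≤ hardy n := by
    rintro g ⟨h, hh, hg⟩
    -- Here `f(ω⁻¹λ) = Φ(λ) g(ω⁻¹λ)`, so the rotate of `g` lies in `H₊`, and hence `g` does.
    obtain ⟨f, hf⟩ := exists_coeFn_eq_act hm hU h
    have hfW : rot n ω⁻¹ f ∈ W := hW.rot_inv_mem hω (hWΦ ▸ ⟨_, hh, hf⟩)
    rw [hWΦ, mem_mulImage_iff_of_eq hU (h := rot n ω⁻¹ g)] at hfW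
    · have := rot_mem_hardy hfW ω
      rwa [rot_rot, inv_mul_cancel, rot_one] at this
    filter_upwards [coeFn_rot ω⁻¹ f, ae_rotate hf ω⁻¹, coeFn_rot ω⁻¹ g, ae_rotate hg ω⁻¹, hU]
      with x h1 h2 h3 h4 h5
    rw [h1, h2, h3, h4, star_mul, star_star, act_mul, mul_inv_cancel_left, ← act_mul (Φ x),
      ← act_mul, mul_star_self_of_mem h5, one_mul]
  obtain ⟨φ, hφ, h⟩ := exists_const_of_mulImage_hardy_le hUm hUmem h1 h2
  refine ⟨φ, hφ, ?_⟩
  filter_upwards [h, hU] with x h3 h4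
  rw [← h3, ← mul_assoc, mul_star_self_of_mem h4, one_mul]

end Constancy

end KSymmetric

namespace KSymmetric

open Filter Finset

/-! ### Projection families and Hardy spaces with constrained coefficients. -/

section Projections

variable {n : ℕ}

/-- `P_0, …, P_{k-1}` are mutually orthogonal projections with sum the identity. -/
structure IsProjFamily (k : ℕ) (P : ℕ → Mat n) : Prop where
  star_eq : ∀ j < k, star (P j) = P j
  mul_eq : ∀ i < k, ∀ j < k, P i * P j = if i = j then P j else 0
  sum_eq : ∑ j ∈ range k, P j = 1

/-- The matrix polynomial `∑_{j<k} λ^j P_j`. -/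
noncomputable def laurent (k : ℕ) (P : ℕ → Mat n) (x : Circle) : Mat n :=
  ∑ j ∈ range k, (x : ℂ) ^ j • P j

variable {k : ℕ} {P : ℕ → Mat n}

theorem laurent_one : laurent k P 1 = ∑ j ∈ range k, P j := by
  simp [laurent]

theorem star_circle_pow (x : Circle) (j : ℕ) : star ((x : ℂ) ^ j) = ((x : ℂ) ^ j)⁻¹ := by
  have h : star ((x : ℂ)) = (x : ℂ)⁻¹ := by
    rw [← Circle.coe_inv, Circle.coe_inv_eq_conj]; rfl
  rw [star_pow, h, inv_pow]

theorem IsProjFamily.star_laurent (hP : IsProjFamily k P) (x : Circle) :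
    star (laurent k P x) = ∑ j ∈ range k, ((x : ℂ) ^ j)⁻¹ • P j := by
  rw [laurent, star_sum]
  refine sum_congr rfl fun j hj => ?_
  rw [star_smul, hP.star_eq j (mem_range.1 hj), star_circle_pow]

theorem IsProjFamily.mul_sum (hP : IsProjFamily k P) {c : ℕ → ℂ} {i : ℕ} (hi : i < k) :
    P i * ∑ j ∈ range k, c j • P j = c i • P i := by
  rw [Finset.mul_sum, sum_eq_single_of_mem i (mem_range.2 hi)]
  · rw [mul_smul_comm, hP.mul_eq i hi i hi, if_pos rfl]
  · intro j hj hji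
    rw [mul_smul_comm, hP.mul_eq i hi j (mem_range.1 hj), if_neg hji.symm, smul_zero]

theorem IsProjFamily.laurent_mem (hP : IsProjFamily k P) (x : Circle) : laurent k P x ∈ Un n := by
  rw [Matrix.mem_unitaryGroup_iff, hP.star_laurent, laurent, Finset.sum_mul, ← hP.sum_eq]
  refine sum_congr rfl fun j hj => ?_
  rw [smul_mul_assoc, hP.mul_sum (mem_range.1 hj), smul_smul, mul_inv_cancel₀, one_smul]
  exact pow_ne_zero _ (Circle.coe_ne_zero x)

theorem isMeasurable_laurent : IsMeasurable (laurent k P) := by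
  refine isMeasurable_of_continuous fun a b => ?_
  simp only [laurent, Matrix.sum_apply, Matrix.smul_apply]
  fun_prop

theorem IsProjFamily.act_mul (hP : IsProjFamily k P) {i j : ℕ} (hi : i < k) (hj : j < k)
    (v : Cn n) : act (P i) (act (P j) v) = if i = j then act (P j) v else 0 := by
  rw [← KSymmetric.act_mul, hP.mul_eq i hi j hj]
  split_ifs
  · rfl
  · exact act_zero_left v

/-- The space of functions in `H₊` whose `i`-th Fourier coefficient lies in `α_i` for
`0 ≤ i ≤ k - 2`. -/
noncomputable def constrainedHardy (k : ℕ) (α : ℕ → Submodule ℂ (Cn n)) : Submodule ℂ (L2 n) :=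
  hardy n ⊓ ⨅ i ∈ range (k - 1), (α i).comap (coefficientₗ n i)

theorem mem_constrainedHardy {α : ℕ → Submodule ℂ (Cn n)} {f : L2 n} :
    f ∈ constrainedHardy k α ↔ (∀ m : ℤ, m < 0 → fourierCoefficient f m = 0) ∧
      ∀ i : ℕ, i < k - 1 → fourierCoefficient f i ∈ α i := by
  simp [constrainedHardy, Submodule.mem_iInf, mem_hardy, coefficientₗ_apply]

/-- Multiplication by `∑ λ^j P_j` maps `H₊` onto a space described by finitely many conditions on
Fourier coefficients. -/
theorem IsProjFamily.mulImage_laurent (hP : IsProjFamily k P) {α : ℕ → Submodule ℂ (Cn n)}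
    (hα : ∀ i < k - 1, ∀ v, v ∈ α i ↔ ∀ l < k, i < l → act (P l) v = 0) :
    mulImage (laurent k P) (hardy n) = constrainedHardy k α := by
  have hU : ∀ᵐ x ∂circleMeasure, laurent k P x ∈ Un n :=
    Eventually.of_forall hP.laurent_mem
  ext g
  rw [mem_constrainedHardy]
  constructor
  · rintro ⟨h, hh, hg⟩
    have hc : ∀ m : ℤ, fourierCoefficient g m =
        ∑ j ∈ range k, act (P j) (fourierCoefficient h (m - j)) := by
      refine coefficient_of_coeFn_eq_sum _ (fun j : ℕ => (j : ℤ)) P (hg.mono fun x hx => ?_)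
      simp [hx, laurent, act_sum_left, act_smul_left]
    refine ⟨fun m hm => ?_, fun i hi => ?_⟩
    · rw [hc]
      refine sum_eq_zero fun j _ => ?_
      rw [hh _ (by omega), act_zero]
    · rw [hα i hi, hc]
      intro l hl hil
      rw [act, map_sum]
      refine sum_eq_zero fun j hj => ?_
      change act (P l) (act (P j) _) = 0
      rw [hP.act_mul hl (mem_range.1 hj)]
      split_ifs with hlj
      · rw [hh _ (by omega), act_zero]
      · rfl
  · rintro ⟨h1, h2⟩
    obtain ⟨h, hh⟩ := exists_coeFn_eq_act isMeasurable_laurent.star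
      (hU.mono fun x hx => star_mem_Un hx) g
    refine ⟨h, ?_, ?_⟩
    · have hc : ∀ m : ℤ, fourierCoefficient h m =
          ∑ j ∈ range k, act (P j) (fourierCoefficient g (m - -(j : ℤ))) := by
        refine coefficient_of_coeFn_eq_sum _ (fun j : ℕ => -(j : ℤ)) P (hh.mono fun x hx => ?_)
        simp [hx, hP.star_laurent, act_sum_left, act_smul_left]
      intro m hm
      rw [hc]
      refine sum_eq_zero fun j hj => ?_
      have hj' := mem_range.1 hj
      -- If `i = m + j ≥ 0` while `m < 0`, then `i < j ≤ k - 1`, so the `i`-th coefficient lies in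
      -- `α_i` and `P_j` kills it.
      rcases lt_or_ge (m - -(j : ℤ)) 0 with hneg | hpos
      · rw [h1 _ hneg, act_zero]
      · obtain ⟨i, hi⟩ := Int.eq_ofNat_of_zero_le hpos
        rw [hi]
        exact (hα i (by omega) _).1 (h2 i (by omega)) j hj' (by omega)
    · filter_upwards [hh, hU] with x hx1 hx2
      rw [hx1, act_act_star hx2]

/-- On all of `L²(S¹)` the shift is invertible; the inverse power is multiplication by `λ^(-N)`. -/
theorem exists_shift_pow_eq (N : ℕ) (g : L2 n) : ∃ f, (shift n ^ N) f = g := by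
  have hm := memLp_smul (continuous_zpow (-(N : ℤ))) g
  refine ⟨hm.toLp _, Lp.ext ?_⟩
  filter_upwards [coeFn_shift_pow N (hm.toLp _), hm.coeFn_toLp] with x h1 h2
  rw [h1, h2, smul_smul, ← Circle.coe_mul]
  simp

theorem constrainedHardy_eq (k : ℕ) (α : ℕ → Submodule ℂ (Cn n)) :
    constrainedHardy k α = (⨆ j ∈ range (k - 1), (constants (α j)).map (shift n ^ j)) ⊔
      (hardy n).map (shift n ^ (k - 1)) := by
  have hcoef : ∀ (j : ℕ) (c : Cn n) (m : ℤ), fourierCoefficient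
      ((shift n ^ j) (Lp.constₗ 2 circleMeasure ℂ c)) m = if m = j then c else 0 := by
    intro j c m
    rw [coefficient_shift_pow, coefficient_const]
    simp only [sub_eq_zero]
  refine le_antisymm ?_ (sup_le (iSup₂_le ?_) ?_)
  · intro g hg
    rw [mem_constrainedHardy] at hg
    -- The Fourier polynomial of `g` in degrees below `k - 1`; what remains is divisible by
    -- `λ^(k-1)` in `H₊`.
    set s : L2 n := ∑ j ∈ range (k - 1),
      (shift n ^ j) (Lp.constₗ 2 circleMeasure ℂ (fourierCoefficient g j)) with hs
    obtain ⟨f, hf⟩ := exists_shift_pow_eq (k - 1) (g - s)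
    rw [← add_sub_cancel s g, ← hf]
    refine Submodule.add_mem_sup ?_ ⟨f, ?_, rfl⟩
    · exact Submodule.sum_mem _ fun j hj =>
        (le_iSup₂_of_le (f := fun j _ => (constants (α j)).map (shift n ^ j)) j hj le_rfl)
          ⟨_, ⟨_, hg.2 j (mem_range.1 hj), rfl⟩, rfl⟩
    · intro m hm
      have h1 := coefficient_shift_pow f (k - 1) (m + (k - 1 : ℕ))
      rw [add_sub_cancel_right] at h1
      rw [← h1, hf, ← coefficientₗ_apply, map_sub, hs, map_sum]
      simp only [coefficientₗ_apply, hcoef]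
      rcases lt_or_ge (m + (k - 1 : ℕ)) 0 with hneg | hpos
      · rw [hg.1 _ hneg, zero_sub, neg_eq_zero]
        exact sum_eq_zero fun j _ => if_neg (by omega)
      · obtain ⟨i, hi⟩ := Int.eq_ofNat_of_zero_le hpos
        rw [hi, sum_eq_single_of_mem i (mem_range.2 (by omega)), if_pos rfl, sub_self]
        exact fun j _ hji => if_neg (by omega)
  · rintro j hj - ⟨-, ⟨c, hc, rfl⟩, rfl⟩
    rw [mem_constrainedHardy]
    refine ⟨fun m hm => ?_, fun i _ => ?_⟩
    · rw [hcoef, if_neg (by omega)]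
    · rw [hcoef]
      split_ifs with hij
      · have : i = j := by exact_mod_cast hij
        exact this ▸ hc
      · exact zero_mem _
  · rintro - ⟨f, hf, rfl⟩
    rw [mem_constrainedHardy]
    refine ⟨fun m hm => ?_, fun i hi => ?_⟩
    · rw [coefficient_shift_pow, hf _ (by omega)]
    · rw [coefficient_shift_pow, hf _ (by omega)]
      exact zero_mem _

theorem act_projMatrix (α : Submodule ℂ (Cn n)) (v : Cn n) :
    act (projMatrix α) v = α.starProjection v := by
  rw [act, projMatrix, StarAlgEquiv.apply_symm_apply]

theorem star_projMatrix (α : Submodule ℂ (Cn n)) : star (projMatrix α) = projMatrix α := by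
  refine EquivLike.injective (Matrix.toEuclideanCLM (n := Fin n) (𝕜 := ℂ)) ?_
  rw [map_star, projMatrix, StarAlgEquiv.apply_symm_apply]
  exact isSelfAdjoint_starProjection α

/-- Lets the general description of `L H₊` be reused with two projections, which handles the
multiplier `π_α + λ π_α^⊥`. -/
theorem isProjFamily_pair (α : Submodule ℂ (Cn n)) :
    IsProjFamily 2 fun j => if j = 0 then projMatrix α else projMatrix αᗮ := by
  have hadd : projMatrix α + projMatrix αᗮ = 1 := ext_act fun v => by
    rw [act_add_left, act_projMatrix, act_projMatrix, act_one, Submodule.starProjection_orthogonal']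
    simp
  have hsq : ∀ β : Submodule ℂ (Cn n), projMatrix β * projMatrix β = projMatrix β := fun β =>
    ext_act fun v => by
      rw [act_mul, act_projMatrix, act_projMatrix]
      exact Submodule.starProjection_eq_self_iff.2 (Submodule.starProjection_apply_mem β v)
  have h1 : projMatrix αᗮ = 1 - projMatrix α := eq_sub_of_add_eq' hadd
  constructor
  · intro j _
    split_ifs <;> exact star_projMatrix _
  · intro i hi j hj
    interval_cases i <;> interval_cases j <;> simp [hsq]
    · rw [h1, mul_sub, hsq, mul_one, sub_self]
    · rw [h1, sub_mul, hsq, one_mul, sub_self]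
  · simpa [sum_range_succ] using hadd

theorem laurent_pair (α : Submodule ℂ (Cn n)) (x : Circle) :
    laurent 2 (fun j => if j = 0 then projMatrix α else projMatrix αᗮ) x
      = projMatrix α + (x : ℂ) • projMatrix αᗮ := by
  simp [laurent, sum_range_succ]

theorem mulImage_pair (α : Submodule ℂ (Cn n)) :
    mulImage (fun x : Circle => projMatrix α + (x : ℂ) • projMatrix αᗮ) (hardy n)
      = constrainedHardy 2 fun _ => α := by
  rw [← (isProjFamily_pair α).mulImage_laurent (α := fun _ => α)]
  · congr 1
    funext x
    exact (laurent_pair α x).symm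
  · intro i hi v
    have hi0 : i = 0 := by omega
    subst hi0
    have h : (∀ l < 2, 0 < l → act (if l = 0 then projMatrix α else projMatrix αᗮ) v = 0) ↔
        act (projMatrix αᗮ) v = 0 := by
      refine ⟨fun h => by simpa using h 1 (by norm_num) (by norm_num), fun h l _ hl => ?_⟩
      rwa [if_neg hl.ne']
    rw [h, act_projMatrix, Submodule.starProjection_orthogonal']
    rw [sub_apply, sub_eq_zero]
    exact ⟨fun h => (Submodule.starProjection_eq_self_iff.2 h).symm,
      fun h => Submodule.starProjection_eq_self_iff.1 h.symm⟩

theorem constrainedHardy_two (α : Submodule ℂ (Cn n)) :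
    constrainedHardy 2 (fun _ => α) = constants α ⊔ (hardy n).map (shift n) := by
  rw [constrainedHardy_eq]
  simp [Module.End.one_eq_id]

end Projections

end KSymmetric

namespace KSymmetric

open Filter Finset

/-! ### Spectral projections of the monodromy. -/

section Spectral

variable {n : ℕ}

/-- The spectral projection of a matrix `φ` with `φ^k = 1` for the eigenvalue `ω^j`. -/
noncomputable def spectralProj (k : ℕ) (ω : Circle) (φ : Mat n) (j : ℕ) : Mat n :=
  (k : ℂ)⁻¹ • ∑ i ∈ range k, (((ω : ℂ) ^ j)⁻¹ • φ) ^ i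

variable {k : ℕ} {ω : Circle} {φ : Mat n}

theorem coe_pow_ne_zero (ω : Circle) (j : ℕ) : (ω : ℂ) ^ j ≠ 0 :=
  pow_ne_zero _ (Circle.coe_ne_zero ω)

theorem isPrimitiveRoot_coe (hω : IsPrimitiveRoot ω k) : IsPrimitiveRoot (ω : ℂ) k :=
  hω.map_of_injective (f := Circle.coeHom) Circle.coe_injective

theorem root_of_unity_orthogonality (hω : IsPrimitiveRoot ω k) {i j : ℕ} (hi : i < k) (hj : j < k) :
    (k : ℂ)⁻¹ * ∑ l ∈ range k, (((ω : ℂ) ^ j)⁻¹ * (ω : ℂ) ^ i) ^ l = if i = j then 1 else 0 := by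
  have hω' := isPrimitiveRoot_coe hω
  split_ifs with hij
  · have hk : (k : ℂ) ≠ 0 := Nat.cast_ne_zero.2 (by omega)
    simp [hij, inv_mul_cancel₀ hk]
  · have h1 : ((ω : ℂ) ^ j)⁻¹ * (ω : ℂ) ^ i ≠ 1 := by
      intro h
      rw [inv_mul_eq_one₀ (coe_pow_ne_zero ω j)] at h
      exact hij (hω'.pow_inj hj hi h).symm
    have h2 : (((ω : ℂ) ^ j)⁻¹ * (ω : ℂ) ^ i) ^ k = 1 := by
      rw [mul_pow, inv_pow, ← pow_mul, ← pow_mul, mul_comm j, mul_comm i, pow_mul, pow_mul,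
        hω'.pow_eq_one]
      simp
    rw [geom_sum_eq h1, h2, sub_self, zero_div, mul_zero]

theorem act_pow_of_eigen {A : Mat n} {v : Cn n} {c : ℂ} (h : act A v = c • v) (l : ℕ) :
    act (A ^ l) v = c ^ l • v := by
  induction l with
  | zero => simp [act_one]
  | succ l ih => rw [pow_succ, act_mul, h, act_smul, ih, smul_smul, pow_succ']

theorem act_average_of_eigen {A : Mat n} {v : Cn n} {c : ℂ} (h : act A v = c • v) (k : ℕ) :
    act ((k : ℂ)⁻¹ • ∑ i ∈ range k, A ^ i) v = ((k : ℂ)⁻¹ * ∑ i ∈ range k, c ^ i) • v := by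
  rw [act_smul_left, act_sum_left, mul_smul, Finset.sum_smul]
  simp only [act_pow_of_eigen h]

theorem act_spectralProj_of_eigen (hω : IsPrimitiveRoot ω k) {i j : ℕ} (hi : i < k) (hj : j < k)
    {v : Cn n} (hv : act φ v = (ω : ℂ) ^ i • v) :
    act (spectralProj k ω φ j) v = if i = j then v else 0 := by
  rw [spectralProj, act_average_of_eigen (c := ((ω : ℂ) ^ j)⁻¹ * (ω : ℂ) ^ i),
    root_of_unity_orthogonality hω hi hj]
  · simp
  · rw [act_smul_left, hv, smul_smul]

/-- An eigenvector of a unitary matrix is an eigenvector of the adjoint with the inverse eigenvalue,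
so the averages agree on it with those for `φ`. -/
theorem act_star_spectralProj_of_eigen (hω : IsPrimitiveRoot ω k) (hφ : φ ∈ Un n) {i j : ℕ}
    (hi : i < k) (hj : j < k) {v : Cn n} (hv : act φ v = (ω : ℂ) ^ i • v) :
    act (star (spectralProj k ω φ j)) v = if i = j then v else 0 := by
  have h1 : star (spectralProj k ω φ j)
      = (k : ℂ)⁻¹ • ∑ i ∈ range k, ((ω : ℂ) ^ j • star φ) ^ i := by
    rw [spectralProj, star_smul, star_sum]
    congr 1
    · simp
    · refine sum_congr rfl fun l _ => ?_
      rw [star_pow, star_smul, star_inv₀, star_circle_pow, inv_inv]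
  have h2 : act (star φ) v = ((ω : ℂ) ^ i)⁻¹ • v := by
    have h3 := act_star_act hφ v
    rw [hv, act_smul] at h3
    conv_rhs => rw [← h3]
    rw [smul_smul, inv_mul_cancel₀ (coe_pow_ne_zero ω i), one_smul]
  rw [h1, act_average_of_eigen (c := ((ω : ℂ) ^ i)⁻¹ * (ω : ℂ) ^ j),
    root_of_unity_orthogonality hω hj hi]
  · simp [eq_comm]
  · rw [act_smul_left, h2, smul_smul, mul_comm]

/-- With `A = ω^(-j) φ` one has `A^k = 1`, so multiplying by `A` permutes the terms of the average.
-/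
theorem mul_spectralProj (hω : IsPrimitiveRoot ω k) (hφk : φ ^ k = 1) (j : ℕ) :
    φ * spectralProj k ω φ j = (ω : ℂ) ^ j • spectralProj k ω φ j := by
  have hω' := isPrimitiveRoot_coe hω
  set A : Mat n := ((ω : ℂ) ^ j)⁻¹ • φ with hA
  have hAk : A ^ k = 1 := by
    rw [hA, smul_pow, hφk, inv_pow, ← pow_mul, mul_comm j, pow_mul, hω'.pow_eq_one]
    simp
  have hφA : φ = (ω : ℂ) ^ j • A := by
    rw [hA, smul_smul, mul_inv_cancel₀ (coe_pow_ne_zero ω j), one_smul]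
  have h1 : A * ∑ i ∈ range k, A ^ i = ∑ i ∈ range k, A ^ i := by
    have := mul_geom_sum A k
    rwa [hAk, sub_self, sub_mul, one_mul, sub_eq_zero] at this
  rw [spectralProj, ← hA]
  conv_lhs => rw [hφA]
  rw [smul_mul_assoc, mul_smul_comm, h1]

theorem act_spectralProj_eigen (hω : IsPrimitiveRoot ω k) (hφk : φ ^ k = 1) (j : ℕ) (v : Cn n) :
    act φ (act (spectralProj k ω φ j) v) = (ω : ℂ) ^ j • act (spectralProj k ω φ j) v := by
  rw [← act_mul, mul_spectralProj hω hφk, act_smul_left]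

/-- After exchanging the sums, orthogonality of roots of unity leaves only the term `φ^0`. -/
theorem sum_spectralProj (hω : IsPrimitiveRoot ω k) (hk : 0 < k) :
    ∑ j ∈ range k, spectralProj k ω φ j = 1 := by
  simp only [spectralProj, smul_pow]
  rw [← Finset.smul_sum, Finset.sum_comm]
  simp only [← Finset.sum_smul]
  rw [Finset.smul_sum, sum_eq_single_of_mem 0 (mem_range.2 hk)]
  · simp [(Nat.cast_ne_zero (R := ℂ)).2 hk.ne']
  · intro l hl hl0
    have h := root_of_unity_orthogonality hω hk (mem_range.1 hl)
    rw [if_neg hl0.symm] at h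
    rw [smul_smul]
    convert zero_smul ℂ (φ ^ l)
    rw [← h]
    congr 1
    refine sum_congr rfl fun i _ => ?_
    simp only [pow_zero, mul_one, inv_pow, ← pow_mul, mul_comm i]

/-- Both identities reduce to eigenvectors: every vector is the sum of its images under the `P_j`,
and these images are eigenvectors. -/
theorem isProjFamily_spectralProj (hω : IsPrimitiveRoot ω k) (hk : 0 < k) (hφ : φ ∈ Un n)
    (hφk : φ ^ k = 1) : IsProjFamily k (spectralProj k ω φ) where
  star_eq j hj := ext_act fun v => by
    have hv : v = ∑ i ∈ range k, act (spectralProj k ω φ i) v := by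
      rw [← act_sum_left, sum_spectralProj hω hk, act_one]
    rw [hv]
    simp only [act, map_sum]
    refine sum_congr rfl fun i hi => ?_
    have he := act_spectralProj_eigen hω hφk i v
    exact (act_star_spectralProj_of_eigen hω hφ (mem_range.1 hi) hj he).trans
      (act_spectralProj_of_eigen hω (mem_range.1 hi) hj he).symm
  mul_eq i hi j hj := ext_act fun v => by
    rw [act_mul, act_spectralProj_of_eigen hω hj hi (act_spectralProj_eigen hω hφk j v)]
    simp only [eq_comm (a := i)]
    split_ifs
    · rfl
    · rw [act_zero_left]
  sum_eq := sum_spectralProj hω hk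

theorem mem_beta {j : ℕ} {v : Cn n} : v ∈ beta ω φ j ↔ act φ v = (ω : ℂ) ^ j • v := by
  have h : Matrix.toEuclideanLin (φ - (ω : ℂ) ^ j • (1 : Mat n)) v
      = act (φ - (ω : ℂ) ^ j • (1 : Mat n)) v := rfl
  rw [beta, LinearMap.mem_ker, h, sub_eq_add_neg, ← neg_smul, act_add_left, act_smul_left, act_one,
    neg_smul, ← sub_eq_add_neg, sub_eq_zero]

theorem isOrtho_beta (hω : IsPrimitiveRoot ω k) (hφ : φ ∈ Un n) (hφk : φ ^ k = 1) {i j : ℕ}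
    (hi : i < k) (hj : j < k) (hij : i ≠ j) : beta ω φ i ⟂ beta ω φ j := by
  rw [Submodule.isOrtho_iff_inner_eq]
  intro v hv w hw
  have hP := isProjFamily_spectralProj hω (by omega) hφ hφk
  have h1 := act_spectralProj_of_eigen hω hi hi (mem_beta.1 hv)
  have h2 := act_spectralProj_of_eigen hω hj hi (mem_beta.1 hw)
  rw [if_pos rfl] at h1
  rw [if_neg hij.symm] at h2
  rw [← h1, ← hP.star_eq i hi, ← inner_act, h2, inner_zero_right]

/-- Trades the geometric projection for a polynomial in `φ`, which is what makes smooth dependence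
on `φ` visible. -/
theorem projMatrix_beta (hω : IsPrimitiveRoot ω k) (hφ : φ ∈ Un n) (hφk : φ ^ k = 1) {j : ℕ}
    (hj : j < k) : projMatrix (beta ω φ j) = spectralProj k ω φ j := by
  have hP := isProjFamily_spectralProj hω (by omega) hφ hφk
  refine ext_act fun v => ?_
  rw [act_projMatrix]
  refine Submodule.eq_starProjection_of_mem_of_inner_eq_zero
    (mem_beta.2 (act_spectralProj_eigen hω hφk j v)) fun w hw => ?_
  have h1 := act_spectralProj_of_eigen hω hj hj (mem_beta.1 hw)
  rw [if_pos rfl] at h1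
  rw [← h1, inner_act, hP.star_eq j hj]
  have h2 : act (spectralProj k ω φ j) (v - act (spectralProj k ω φ j) v) = 0 := by
    rw [act, map_sub]
    change act (spectralProj k ω φ j) v - act (spectralProj k ω φ j) (act _ v) = 0
    rw [hP.act_mul hj hj, if_pos rfl, sub_self]
  rw [h2, inner_zero_left]

theorem untwist_eq (hω : IsPrimitiveRoot ω k) (hk : 0 < k) (hφ : φ ∈ Un n) (hφk : φ ^ k = 1)
    (Φ : Circle → Mat n) (x : Circle) :
    untwist k ω φ Φ x = Φ x * star (laurent k (spectralProj k ω φ) x) := by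
  rw [untwist, (isProjFamily_spectralProj hω hk hφ hφk).star_laurent]
  congr 1
  exact sum_congr rfl fun j hj => by rw [projMatrix_beta hω hφ hφk (mem_range.1 hj)]

/-- The eigenspaces decompose `ℂⁿ`, so belonging to the first ones means having no component in the
later ones. This is the form needed by `mulImage_laurent`. -/
theorem mem_alpha (hω : IsPrimitiveRoot ω k) (hφk : φ ^ k = 1) {i : ℕ}
    (hi : i < k) (v : Cn n) :
    v ∈ alpha ω φ i ↔ ∀ l < k, i < l → act (spectralProj k ω φ l) v = 0 := by
  constructor
  · intro hv l hl hil
    have hle : alpha ω φ i ≤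
        LinearMap.ker (Matrix.toEuclideanCLM (𝕜 := ℂ) (spectralProj k ω φ l)).toLinearMap := by
      refine iSup₂_le fun j hj w hw => ?_
      have hj' := mem_range.1 hj
      have h := act_spectralProj_of_eigen hω (by omega) hl (mem_beta.1 hw)
      rwa [if_neg (by omega)] at h
    exact hle hv
  · intro h
    have hv : v = ∑ j ∈ range k, act (spectralProj k ω φ j) v := by
      rw [← act_sum_left, sum_spectralProj hω (by omega), act_one]
    rw [hv]
    refine Submodule.sum_mem _ fun j hj => ?_
    rcases le_or_gt j i with hji | hij
    · exact (le_iSup₂_of_le (f := fun l _ => beta ω φ l) j (mem_range.2 (by omega)) le_rfl)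
        (mem_beta.2 (act_spectralProj_eigen hω hφk j v))
    · rw [h j (mem_range.1 hj) hij]
      exact zero_mem _

theorem alpha_mono {i j : ℕ} (h : i ≤ j) : alpha ω φ i ≤ alpha ω φ j :=
  biSup_mono fun _ hl => mem_range.2 (by have := mem_range.1 hl; omega)

end Spectral

/-! ### Roots on the circle and functions of `λᵏ`. -/

section Roots

variable {n k : ℕ} {ω : Circle}

theorem exists_eq_pow_mul [NeZero k] (hω : IsPrimitiveRoot ω k) {x y : Circle} (h : y ^ k = x ^ k) :
    ∃ i < k, y = ω ^ i * x := by
  have h1 : ((y / x : Circle) : ℂ) ^ k = 1 := by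
    rw [← Circle.coe_pow, div_pow, h, div_self', Circle.coe_one]
  obtain ⟨i, hi, h2⟩ := (isPrimitiveRoot_coe hω).eq_pow_of_pow_eq_one h1
  refine ⟨i, hi, ?_⟩
  rw [← Circle.coe_pow] at h2
  rw [Circle.coe_injective h2, div_mul_cancel]

/-- A Borel choice of `k`-th roots on the circle. -/
noncomputable def argRoot (k : ℕ) (x : Circle) : Circle := Circle.exp (Complex.arg x / k)

theorem measurable_argRoot : Measurable (argRoot k) := by
  have hc : Continuous fun x : Circle => (x : ℂ) := continuous_subtype_val
  exact Circle.exp.continuous.measurable.comp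
    ((Complex.measurable_arg.comp hc.measurable).div_const _)

variable [NeZero k]

theorem argRoot_pow (x : Circle) : argRoot k x ^ k = x := by
  have hk : (k : ℝ) ≠ 0 := Nat.cast_ne_zero.mpr (NeZero.ne k)
  rw [argRoot, ← Circle.exp_nsmul, nsmul_eq_mul, mul_div_cancel₀ _ hk, Circle.exp_arg]

/-- Pulled back along `λ ↦ λᵏ`, the preimage of a null set lies in a finite union of its rotates by
powers of `ω`. -/
theorem quasiMeasurePreserving_argRoot (hω : IsPrimitiveRoot ω k) :
    Measure.QuasiMeasurePreserving (argRoot k) circleMeasure circleMeasure := by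
  refine ⟨measurable_argRoot, Measure.AbsolutelyContinuous.mk fun s hs h0 => ?_⟩
  rw [Measure.map_apply measurable_argRoot hs,
    ← (measurePreserving_pow k).measure_preimage (measurable_argRoot hs).nullMeasurableSet]
  have h1 : ∀ᵐ x ∂circleMeasure, ∀ i : ℕ, ω ^ i * x ∉ s :=
    ae_all_iff.2 fun i => ae_rotate (measure_eq_zero_iff_ae_notMem.1 h0) (ω ^ i)
  refine measure_eq_zero_iff_ae_notMem.2 (h1.mono fun x hx hmem => ?_)
  obtain ⟨i, -, hi⟩ := exists_eq_pow_mul hω (argRoot_pow (k := k) (x ^ k))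
  exact hx i (hi ▸ hmem)

theorem ae_comp_pow {p : Circle → Prop} (h : ∀ᵐ x ∂circleMeasure, p x) :
    ∀ᵐ x ∂circleMeasure, p (x ^ k) :=
  (measurePreserving_pow k).quasiMeasurePreserving.ae h

theorem ae_of_ae_pow (hω : IsPrimitiveRoot ω k) {p : Circle → Prop}
    (h : ∀ᵐ x ∂circleMeasure, p (x ^ k)) : ∀ᵐ x ∂circleMeasure, p x := by
  filter_upwards [(quasiMeasurePreserving_argRoot hω).ae h] with x hx
  rwa [argRoot_pow] at hx

/-- Iterating an a.e. relation between values at `ωλ` and at `λ`. -/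
theorem ae_forall_pow {X : Type*} {F : Circle → X} {T : X → X}
    (h : ∀ᵐ x ∂circleMeasure, F (ω * x) = T (F x)) :
    ∀ᵐ x ∂circleMeasure, ∀ i : ℕ, F (ω ^ i * x) = T^[i] (F x) := by
  have h1 : ∀ᵐ x ∂circleMeasure, ∀ i : ℕ, F (ω * (ω ^ i * x)) = T (F (ω ^ i * x)) :=
    ae_all_iff.2 fun i => ae_rotate h (ω ^ i)
  filter_upwards [h1] with x hx i
  induction i with
  | zero => simp
  | succ i ih => rw [pow_succ', mul_assoc, hx, ih, Function.iterate_succ_apply']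

theorem rot_twist (hω : ω ^ k = 1) (j : ℕ) (f : L2 n) :
    rot n ω (twist n k j f) = (ω : ℂ) ^ j • twist n k j f := by
  refine Lp.ext ?_
  filter_upwards [coeFn_rot ω (twist n k j f), coeFn_twist k j f, ae_rotate (coeFn_twist k j f) ω,
    Lp.coeFn_smul ((ω : ℂ) ^ j) (twist n k j f)] with x h1 h2 h3 h4
  rw [h1, h3, h4, Pi.smul_apply, h2, mul_pow, mul_pow, hω, one_mul, smul_smul, Circle.coe_mul,
    Circle.coe_pow]

/-- A function which is multiplied by `ω^j` under rotation is of the form `λ^j h(λᵏ)`. -/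
theorem exists_twist_eq (hω : IsPrimitiveRoot ω k) (j : ℕ) {f : L2 n}
    (hf : rot n ω f = (ω : ℂ) ^ j • f) : ∃ h : L2 n, twist n k j h = f := by
  -- The only candidate is `λ^(-j) f(λ)` read at a root; the eigenvector equation makes it
  -- independent of the root almost everywhere.
  let g : Circle → Cn n := fun y => (((argRoot k y) ^ (-(j : ℤ)) : Circle) : ℂ) • f (argRoot k y)
  have hf' : ∀ᵐ x ∂circleMeasure, f (ω * x) = (ω : ℂ) ^ j • f x := by
    filter_upwards [coeFn_rot ω f, Lp.coeFn_smul ((ω : ℂ) ^ j) f] with x h1 h2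
    rw [← h1, hf, h2, Pi.smul_apply]
  have hg : ∀ᵐ x ∂circleMeasure, g (x ^ k) = ((x ^ (-(j : ℤ)) : Circle) : ℂ) • f x := by
    filter_upwards [ae_forall_pow (F := f) (T := fun v => (ω : ℂ) ^ j • v) hf'] with x hx
    obtain ⟨i, -, hi⟩ := exists_eq_pow_mul hω (argRoot_pow (k := k) (x ^ k))
    simp only [g]
    rw [hi, hx, smul_iterate_apply, smul_smul, mul_zpow, Circle.coe_mul, mul_right_comm]
    convert rfl using 2
    have h1 : (ω ^ i) ^ (-(j : ℤ)) * (ω ^ j) ^ i = 1 := by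
      rw [zpow_neg, zpow_natCast, ← pow_mul, ← pow_mul, mul_comm j, inv_mul_cancel]
    rw [← Circle.coe_pow, ← Circle.coe_pow, ← Circle.coe_mul, h1, Circle.coe_one, one_mul]
  have hgm : AEStronglyMeasurable g circleMeasure :=
    ((character (-(j : ℤ))).continuous.measurable.comp
      measurable_argRoot).aestronglyMeasurable.smul
      ((Lp.aestronglyMeasurable f).comp_quasiMeasurePreserving (quasiMeasurePreserving_argRoot hω))
  have hgL : MemLp g 2 circleMeasure := by
    have hmp := measurePreserving_pow k
    -- Square integrability is tested after composing with `λ ↦ λᵏ`, where `g` becomes `λ^(-j)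
    -- f(λ)`.
    rw [← hmp.map_eq, memLp_map_measure_iff (by rwa [hmp.map_eq]) hmp.aemeasurable]
    exact (memLp_congr_ae hg).2 (memLp_smul (continuous_zpow _) f)
  refine ⟨hgL.toLp g, Lp.ext ?_⟩
  filter_upwards [coeFn_twist k j (hgL.toLp g),
    (measurePreserving_pow k).quasiMeasurePreserving.ae hgL.coeFn_toLp, hg] with x h1 h2 h3
  rw [h1, h2, h3, smul_smul, ← Circle.coe_mul]
  simp

end Roots

end KSymmetric

namespace KSymmetric

open Filter Finset

/-! ### The filtration and the representation of `W`. -/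

section Representation

theorem monodromy_pow_eq_one {n k : ℕ} {ω : Circle} {φ : Mat n} {Φ : Circle → Mat n}
    (hω : ω ^ k = 1) (hU : ∀ᵐ x ∂circleMeasure, Φ x ∈ Un n)
    (hae : ∀ᵐ x ∂circleMeasure, Φ (ω * x) = Φ x * φ) : φ ^ k = 1 := by
  obtain ⟨x, hx, hxU⟩ := ((ae_forall_pow (T := fun A => A * φ) hae).and hU).exists
  have h := hx k
  rw [hω, one_mul, mul_right_iterate] at h
  replace h : Φ x = Φ x * φ ^ k := h
  calc φ ^ k = star (Φ x) * (Φ x * φ ^ k) := by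
        rw [← mul_assoc, star_mul_self_of_mem hxU, one_mul]
    _ = 1 := by rw [← h, star_mul_self_of_mem hxU]

variable {n k : ℕ} [NeZero k] {ω : Circle}

/-- A twist has coefficients only in degrees `j + kℤ`, and among the constrained degrees `0, …, k -
2` only `j` itself can be of this kind. -/
theorem twist_mem_constrainedHardy (hω : IsPrimitiveRoot ω k) {α : ℕ → Submodule ℂ (Cn n)}
    {j : ℕ} (hj : j < k) (h : L2 n) : twist n k j h ∈ constrainedHardy k α ↔
      h ∈ hardy n ∧ (j < k - 1 → fourierCoefficient h 0 ∈ α j) := by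
  have hk : (0 : ℤ) < k := by omega
  rw [mem_constrainedHardy, mem_hardy]
  constructor
  · rintro ⟨h1, h2⟩
    refine ⟨fun m hm => ?_, fun hj1 => ?_⟩
    · rw [← coefficient_twist_mul k j h m]
      -- For `m ≤ -1` and `j < k` the degree `j + k m` is negative.
      exact h1 _ (by nlinarith)
    · have h3 := coefficient_twist_mul k j h 0
      rw [mul_zero, add_zero] at h3
      exact h3 ▸ h2 j hj1
  · rintro ⟨h1, h2⟩
    refine ⟨fun m hm => ?_, fun i hi => ?_⟩
    · by_cases hd : (k : ℤ) ∣ m - j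
      · obtain ⟨q, hq⟩ := hd
        have hm' : m = j + k * q := by omega
        rw [hm', coefficient_twist_mul]
        exact h1 q (by nlinarith)
      · exact coefficient_twist_eq_zero hω j h hd
    · by_cases hd : (k : ℤ) ∣ i - j
      · have hij : (i : ℤ) - j = 0 :=
          Int.eq_zero_of_abs_lt_dvd hd (abs_lt.2 ⟨by omega, by omega⟩)
        have hij' : i = j := by omega
        subst hij'
        have h3 := coefficient_twist_mul k i h 0
        rw [mul_zero, add_zero] at h3
        exact h3 ▸ h2 hi
      · rw [coefficient_twist_eq_zero hω j h hd]
        exact zero_mem _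

/-- Valid for any subspace: every `ω^j`-eigenvector of the rotation is already in the range of
`twist`. -/
theorem eigenpart_eq_map (hω : IsPrimitiveRoot ω k) (W : Submodule ℂ (L2 n)) (j : ℕ) :
    eigenpart ω W j = (filtrationPart k ω W j).map (twist n k j) := by
  rw [filtrationPart, Submodule.map_comap_eq, right_eq_inf]
  rintro f ⟨-, hf⟩
  obtain ⟨h, hh⟩ := exists_twist_eq hω j (Module.End.mem_eigenspace_iff.1 hf)
  exact ⟨h, hh⟩

theorem mem_filtrationPart (hω : IsPrimitiveRoot ω k) {W : Submodule ℂ (L2 n)} {j : ℕ} {f : L2 n} :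
    f ∈ filtrationPart k ω W j ↔ twist n k j f ∈ W := by
  rw [filtrationPart, Submodule.mem_comap, eigenpart, Submodule.mem_inf, and_iff_left]
  exact Module.End.mem_eigenspace_iff.2 (rot_twist hω.pow_eq_one j f)

/-- The filtration of a space `Ψ(λᵏ) K`, for `K` given by constraints on Fourier coefficients. -/
theorem filtrationPart_eq (hω : IsPrimitiveRoot ω k) {Ψ : Circle → Mat n} (hm : IsMeasurable Ψ)
    (hU : ∀ᵐ x ∂circleMeasure, Ψ x ∈ Un n) {α : ℕ → Submodule ℂ (Cn n)} {W : Submodule ℂ (L2 n)}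
    (hW : W = mulImage (fun x => Ψ (x ^ k)) (constrainedHardy k α)) {j : ℕ} (hj : j < k)
    {A : Submodule ℂ (L2 n)}
    (hA : ∀ h, h ∈ A ↔ h ∈ hardy n ∧ (j < k - 1 → fourierCoefficient h 0 ∈ α j)) :
    filtrationPart k ω W j = mulImage Ψ A := by
  have hUk := ae_comp_pow (k := k) hU
  ext f
  obtain ⟨h, hf⟩ := exists_preimage_act hm hU f
  have hfk := ae_comp_pow (k := k) hf
  have ht : ∀ᵐ x ∂circleMeasure, twist n k j f x = act (Ψ (x ^ k)) (twist n k j h x) := by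
    filter_upwards [coeFn_twist k j f, coeFn_twist k j h, hfk] with x h1 h2 h3
    rw [h1, h2, h3, act_smul]
  have h4 : twist n k j f ∈ W ↔ twist n k j h ∈ constrainedHardy k α := by
    rw [hW]
    exact mem_mulImage_iff_of_eq (F := fun x => Ψ (x ^ k)) hUk ht
  rw [mem_filtrationPart hω, h4, mem_mulImage_iff_of_eq hU hf, hA,
    twist_mem_constrainedHardy hω hj]

theorem represents_of_constrainedHardy (hk : 2 ≤ k) (hω : IsPrimitiveRoot ω k)
    {Ψ : Circle → Mat n} (hm : IsMeasurable Ψ)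
    (hU : ∀ᵐ x ∂circleMeasure, Ψ x ∈ Un n) {α : ℕ → Submodule ℂ (Cn n)}
    (hα : ∀ i j, i ≤ j → j + 2 ≤ k → α i ≤ α j) {W : Submodule ℂ (L2 n)}
    (hW : W = mulImage (fun x => Ψ (x ^ k)) (constrainedHardy k α)) :
    Represents k ω W Ψ α := by
  have hpart : ∀ j, j + 2 ≤ k → filtrationPart k ω W j
      = mulImage Ψ (constrainedHardy 2 fun _ => α j) := fun j hj => by
    refine filtrationPart_eq hω hm hU hW (by omega) fun h => ?_
    rw [mem_constrainedHardy, mem_hardy]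
    refine and_congr_right fun _ => ⟨fun h1 _ => h1 0 (by norm_num), fun h1 i hi => ?_⟩
    obtain rfl : i = 0 := by omega
    exact h1 (by omega)
  refine ⟨hm, hU, fun j _ => eigenpart_eq_map hω W j, ?_, hα, fun j hj => ?_, fun j hj => ?_, ?_⟩
  · refine filtrationPart_eq hω hm hU hW (by omega) fun h => ?_
    rw [and_iff_left]
    -- For `j = k - 1` no coefficient is constrained, so the space is all of `H₊`.
    exact fun h1 => absurd h1 (lt_irrefl _)
  · rw [hpart j hj, ← mulImage_pair, ← mulImage_mul]
    · exact isMeasurable_laurent.congr (Eventually.of_forall (laurent_pair (α j)))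
    · exact Eventually.of_forall fun x =>
        laurent_pair (α j) x ▸ (isProjFamily_pair (α j)).laurent_mem x
  · rw [hpart j hj, constrainedHardy_two]
  · rw [hW, constrainedHardy_eq]

variable {φ : Mat n} {Φ : Circle → Mat n}

/-- On the range of `P_j` the matrix `φ` acts as `ω^j`, which cancels the factor `ω^(-j)` produced
by the rotation. -/
theorem laurent_spectralProj_mul (hω : IsPrimitiveRoot ω k) (hφ : φ ∈ Un n) (hφk : φ ^ k = 1)
    (x : Circle) : φ * star (laurent k (spectralProj k ω φ) (ω * x))
      = star (laurent k (spectralProj k ω φ) x) := by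
  have hP := isProjFamily_spectralProj hω (NeZero.pos k) hφ hφk
  rw [hP.star_laurent, hP.star_laurent, Finset.mul_sum]
  refine sum_congr rfl fun j _ => ?_
  rw [mul_smul_comm, mul_spectralProj hω hφk, smul_smul, Circle.coe_mul, mul_pow, mul_inv_rev,
    inv_mul_cancel_right₀ (coe_pow_ne_zero ω j)]

theorem untwist_mul (hω : IsPrimitiveRoot ω k) (hφ : φ ∈ Un n) (hφk : φ ^ k = 1) {x : Circle}
    (hx : Φ (ω * x) = Φ x * φ) : untwist k ω φ Φ (ω * x) = untwist k ω φ Φ x := by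
  rw [untwist_eq hω (NeZero.pos k) hφ hφk, untwist_eq hω (NeZero.pos k) hφ hφk, hx, mul_assoc,
    laurent_spectralProj_mul hω hφ hφk]

/-- If the monodromy relation holds everywhere then `Φ_k(λ)` depends only on `λᵏ`. -/
theorem untwist_eq_of_pow_eq (hω : IsPrimitiveRoot ω k) (hφ : φ ∈ Un n) (hφk : φ ^ k = 1)
    (h : ∀ x, Φ (ω * x) = Φ x * φ) {x y : Circle} (hxy : x ^ k = y ^ k) :
    untwist k ω φ Φ x = untwist k ω φ Φ y := by
  obtain ⟨i, -, rfl⟩ := exists_eq_pow_mul hω hxy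
  induction i with
  | zero => rw [pow_zero, one_mul]
  | succ i ih =>
    rw [pow_succ', mul_assoc, untwist_mul hω hφ hφk (h _)]
    exact ih (by rw [mul_pow, ← pow_mul, mul_comm i, pow_mul, hω.pow_eq_one, one_pow, one_mul])

theorem untwist_mem (hω : IsPrimitiveRoot ω k) (hφ : φ ∈ Un n) (hφk : φ ^ k = 1) {x : Circle}
    (hx : Φ x ∈ Un n) : untwist k ω φ Φ x ∈ Un n := by
  rw [untwist_eq hω (NeZero.pos k) hφ hφk]
  exact mul_mem hx (star_mem_Un ((isProjFamily_spectralProj hω (NeZero.pos k) hφ hφk).laurent_mem x))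

theorem ae_untwist_root (hω : IsPrimitiveRoot ω k) (hφ : φ ∈ Un n) (hφk : φ ^ k = 1)
    (hae : ∀ᵐ x ∂circleMeasure, Φ (ω * x) = Φ x * φ) {root : Circle → Circle}
    (hroot : ∀ x, root x ^ k = x) :
    ∀ᵐ x ∂circleMeasure, untwist k ω φ Φ x = untwist k ω φ Φ (root (x ^ k)) := by
  filter_upwards [ae_forall_pow (F := untwist k ω φ Φ) (T := id)
    (hae.mono fun x hx => untwist_mul hω hφ hφk hx)] with x hx
  obtain ⟨i, -, hi⟩ := exists_eq_pow_mul hω (hroot (x ^ k))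
  rw [hi, hx, Function.iterate_id, id]

theorem isMeasurable_untwist (hω : IsPrimitiveRoot ω k) (hφ : φ ∈ Un n) (hφk : φ ^ k = 1)
    (hm : IsMeasurable Φ) : IsMeasurable (untwist k ω φ Φ) :=
  (hm.mul isMeasurable_laurent.star).congr
    (Eventually.of_forall fun x => (untwist_eq hω (NeZero.pos k) hφ hφk Φ x).symm)

/-- An arbitrary root function need not be measurable, but almost everywhere the value does not
depend on the root, so measurability passes over from `argRoot`. -/
theorem isMeasurable_untwist_root (hω : IsPrimitiveRoot ω k) (hφ : φ ∈ Un n) (hφk : φ ^ k = 1)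
    (hm : IsMeasurable Φ) (hae : ∀ᵐ x ∂circleMeasure, Φ (ω * x) = Φ x * φ)
    {root : Circle → Circle} (hroot : ∀ x, root x ^ k = x) :
    IsMeasurable fun x => untwist k ω φ Φ (root x) := by
  have h1 : IsMeasurable fun x => untwist k ω φ Φ (argRoot k x) := fun a b =>
    (isMeasurable_untwist hω hφ hφk hm a b).comp_quasiMeasurePreserving
      (quasiMeasurePreserving_argRoot hω)
  refine h1.congr (ae_of_ae_pow hω ?_)
  filter_upwards [ae_untwist_root hω hφ hφk hae hroot,
    ae_untwist_root hω hφ hφk hae (argRoot_pow (k := k))] with x h2 h3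
  rw [← h2, ← h3]

theorem represents_untwist (hk : 2 ≤ k) (hω : IsPrimitiveRoot ω k) (hφ : φ ∈ Un n)
    (hφk : φ ^ k = 1) (hm : IsMeasurable Φ) (hU : ∀ᵐ x ∂circleMeasure, Φ x ∈ Un n)
    (hae : ∀ᵐ x ∂circleMeasure, Φ (ω * x) = Φ x * φ) {W : Submodule ℂ (L2 n)}
    (hW : W = mulImage Φ (hardy n)) {root : Circle → Circle} (hroot : ∀ x, root x ^ k = x) :
    Represents k ω W (fun x => untwist k ω φ Φ (root x)) (alpha ω φ) := by
  have hP := isProjFamily_spectralProj hω (NeZero.pos k) hφ hφk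
  have hr := ae_untwist_root hω hφ hφk hae hroot
  refine represents_of_constrainedHardy hk hω (isMeasurable_untwist_root hω hφ hφk hm hae hroot)
    (ae_of_ae_pow hω ?_) (fun i j hij _ => alpha_mono hij) ?_
  · filter_upwards [hr, hU] with x h1 h2
    exact h1 ▸ untwist_mem hω hφ hφk h2
  · rw [← hP.mulImage_laurent fun i hi v => mem_alpha hω hφk (by omega) v, ← mulImage_mul
      isMeasurable_laurent (Eventually.of_forall hP.laurent_mem), hW]
    refine mulImage_congr (hr.mono fun x hx => ?_) _
    rw [← hx, untwist_eq hω (NeZero.pos k) hφ hφk, mul_assoc,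
      star_mul_self_of_mem (hP.laurent_mem x), mul_one]

theorem exists_untwist_eq_comp_pow (hω : IsPrimitiveRoot ω k) (hφ : φ ∈ Un n) (hφk : φ ^ k = 1)
    (hm : IsMeasurable Φ) (hae : ∀ᵐ x ∂circleMeasure, Φ (ω * x) = Φ x * φ) :
    ∃ F : Circle → Mat n, IsMeasurable F ∧
      ∀ᵐ x ∂circleMeasure, untwist k ω φ Φ x = F (x ^ k) :=
  ⟨_, isMeasurable_untwist_root hω hφ hφk hm hae argRoot_pow,
    ae_untwist_root hω hφ hφk hae argRoot_pow⟩

end Representation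

end KSymmetric

namespace KSymmetric

open Filter Finset

open scoped Manifold ContDiff

/-! ### Partial sums of projection families. -/

theorem IsProjFamily.mul_partialSum {n k : ℕ} {P : ℕ → Mat n} (hP : IsProjFamily k P) {i l : ℕ}
    (hi : i < k) (hl : l < k) :
    P l * ∑ j ∈ range (i + 1), P j = if l ≤ i then P l else 0 := by
  have h : ∀ j ∈ range (i + 1), P l * P j = if l = j then P j else 0 := fun j hj =>
    hP.mul_eq l hl j (by have := mem_range.1 hj; omega)
  rw [Finset.mul_sum, sum_congr rfl h, Finset.sum_ite_eq]
  simp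

theorem IsProjFamily.isIdempotentElem_partialSum {n k : ℕ} {P : ℕ → Mat n}
    (hP : IsProjFamily k P) {i : ℕ} (hi : i < k) :
    (∑ j ∈ range (i + 1), P j) * ∑ j ∈ range (i + 1), P j = ∑ j ∈ range (i + 1), P j := by
  rw [Finset.sum_mul]
  refine sum_congr rfl fun l hl => ?_
  have := mem_range.1 hl
  rw [hP.mul_partialSum hi (by omega), if_pos (by omega)]

/-- Matches the criterion of `mem_alpha`, exhibiting `α_i` as the fixed space of an idempotent. -/
theorem IsProjFamily.act_partialSum_eq_self_iff {n k : ℕ} {P : ℕ → Mat n}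
    (hP : IsProjFamily k P) {i : ℕ} (hi : i < k) (v : Cn n) :
    act (∑ j ∈ range (i + 1), P j) v = v ↔ ∀ l < k, i < l → act (P l) v = 0 := by
  constructor
  · intro h l hl hil
    rw [← h, ← KSymmetric.act_mul, hP.mul_partialSum hi hl, if_neg (by omega), act_zero_left]
  · intro h
    conv_rhs => rw [← act_one v, ← hP.sum_eq]
    rw [act_sum_left, act_sum_left]
    refine sum_subset (range_mono (by omega)) fun l hl hl' => ?_
    exact h l (mem_range.1 hl) (by simpa using hl')

/-! ### Smooth matrix functions and subbundles. -/

section SmoothMatrices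

variable {n : ℕ} {E : Type*} [NormedAddCommGroup E] [NormedSpace ℝ E] {H : Type*}
  [TopologicalSpace H] {N : Type*} [TopologicalSpace N] [ChartedSpace H N]
  {J : ModelWithCorners ℝ E H}

/-- A matrix-valued function on a manifold with smooth entries. -/
def IsSmoothMatrix (J : ModelWithCorners ℝ E H) (F : N → Mat n) : Prop :=
  ∀ a b : Fin n, ContMDiff J 𝓘(ℝ, ℂ) ∞ fun p => F p a b

theorem contMDiff_complex_mul {f g : N → ℂ} (hf : ContMDiff J 𝓘(ℝ, ℂ) ∞ f)
    (hg : ContMDiff J 𝓘(ℝ, ℂ) ∞ g) : ContMDiff J 𝓘(ℝ, ℂ) ∞ fun p => f p * g p :=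
  (contDiff_mul (𝕜 := ℝ) (𝔸 := ℂ)).comp_contMDiff (hf.prodMk_space hg)

theorem contMDiff_complex_sum {ι : Type*} (s : Finset ι) {f : ι → N → ℂ}
    (hf : ∀ i ∈ s, ContMDiff J 𝓘(ℝ, ℂ) ∞ (f i)) :
    ContMDiff J 𝓘(ℝ, ℂ) ∞ fun p => ∑ i ∈ s, f i p :=
  contMDiff_finsetSum hf

theorem isSmoothMatrix_const (A : Mat n) : IsSmoothMatrix J fun _ : N => A :=
  fun _ _ => contMDiff_const

theorem IsSmoothMatrix.mul {F G : N → Mat n} (hF : IsSmoothMatrix J F) (hG : IsSmoothMatrix J G) :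
    IsSmoothMatrix J fun p => F p * G p := fun a b => by
  simp only [Matrix.mul_apply]
  exact contMDiff_complex_sum _ fun i _ => contMDiff_complex_mul (hF a i) (hG i b)

theorem IsSmoothMatrix.add {F G : N → Mat n} (hF : IsSmoothMatrix J F) (hG : IsSmoothMatrix J G) :
    IsSmoothMatrix J fun p => F p + G p := fun a b => (hF a b).add (hG a b)

theorem IsSmoothMatrix.sub {F G : N → Mat n} (hF : IsSmoothMatrix J F) (hG : IsSmoothMatrix J G) :
    IsSmoothMatrix J fun p => F p - G p := fun a b => (hF a b).sub (hG a b)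

theorem IsSmoothMatrix.pow {F : N → Mat n} (hF : IsSmoothMatrix J F) (l : ℕ) :
    IsSmoothMatrix J fun p => F p ^ l := by
  induction l with
  | zero => simpa only [pow_zero] using isSmoothMatrix_const 1
  | succ l ih => simpa only [pow_succ] using ih.mul hF

theorem IsSmoothMatrix.smul {c : N → ℂ} {F : N → Mat n} (hc : ContMDiff J 𝓘(ℝ, ℂ) ∞ c)
    (hF : IsSmoothMatrix J F) : IsSmoothMatrix J fun p => c p • F p := fun a b =>
  contMDiff_complex_mul hc (hF a b)

theorem IsSmoothMatrix.sum {ι : Type*} (s : Finset ι) {F : ι → N → Mat n}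
    (hF : ∀ i ∈ s, IsSmoothMatrix J (F i)) : IsSmoothMatrix J fun p => ∑ i ∈ s, F i p :=
  fun a b => by
    simp only [Matrix.sum_apply]
    exact contMDiff_complex_sum _ fun i hi => hF i hi a b

theorem IsSmoothMatrix.star {F : N → Mat n} (hF : IsSmoothMatrix J F) :
    IsSmoothMatrix J fun p => star (F p) := fun a b =>
  Complex.conjCLE.contDiff.comp_contMDiff (hF b a)

theorem IsSmoothMatrix.continuous {F : N → Mat n} (hF : IsSmoothMatrix J F) : Continuous F :=
  continuous_matrix fun a b => (hF a b).continuous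

theorem IsSmoothMatrix.comp {E' : Type*} [NormedAddCommGroup E'] [NormedSpace ℝ E'] {H' : Type*}
    [TopologicalSpace H'] {N' : Type*} [TopologicalSpace N'] [ChartedSpace H' N']
    {J' : ModelWithCorners ℝ E' H'} {F : N → Mat n} (hF : IsSmoothMatrix J F) {g : N' → N}
    (hg : ContMDiff J' J ∞ g) : IsSmoothMatrix J' fun p => F (g p) :=
  fun a b => (hF a b).comp hg

theorem IsSmoothMatrix.spectralProj {F : N → Mat n} (hF : IsSmoothMatrix J F) (k : ℕ) (ξ : Circle)
    (j : ℕ) : IsSmoothMatrix J fun p => spectralProj k ξ (F p) j :=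
  IsSmoothMatrix.smul contMDiff_const (IsSmoothMatrix.sum _ fun _ _ =>
    (IsSmoothMatrix.smul contMDiff_const hF).pow _)

/-- The ranges of a smooth family of projections form a smooth subbundle. -/
theorem isSmoothSubbundle_of_idempotent {Q : N → Mat n} (hQ : IsSmoothMatrix J Q)
    (hQQ : ∀ z, Q z * Q z = Q z) {α : N → Submodule ℂ (Cn n)}
    (hα : ∀ z v, v ∈ α z ↔ act (Q z) v = v) : IsSmoothSubbundle J α := by
  intro z₀
  -- An intertwiner of `Q z₀` and `Q z` which is the identity at `z₀`. Where it is invertible it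
  -- carries the range of `Q z₀` onto that of `Q z`, so it transports a basis at `z₀` to a smooth
  -- frame.
  let A : N → Mat n := fun z => Q z * Q z₀ + (1 - Q z) * (1 - Q z₀)
  have hA : IsSmoothMatrix J A := (hQ.mul (isSmoothMatrix_const _)).add
    (((isSmoothMatrix_const 1).sub hQ).mul (isSmoothMatrix_const _))
  have hA0 : A z₀ = 1 := by
    simp only [A, mul_sub, sub_mul, hQQ, mul_one, one_mul]
    abel
  have hcomm : ∀ z, A z * Q z₀ = Q z * A z := fun z => by
    simp only [A, mul_add, add_mul, mul_sub, sub_mul, mul_one, one_mul, ← mul_assoc, hQQ]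
    simp only [mul_assoc, hQQ]
    abel
  refine ⟨{z | (A z).det ≠ 0}, ?_, by simp [hA0], Module.finrank ℂ (α z₀),
    fun i z => act (A z) (Module.finBasis ℂ (α z₀) i), ?_, ?_⟩
  · exact isOpen_ne.preimage hA.continuous.matrix_det
  · intro i a
    refine ContMDiff.contMDiffOn ?_
    simp only [act_apply]
    exact contMDiff_complex_sum _ fun b _ => contMDiff_complex_mul (hA a b) contMDiff_const
  · intro z hz
    have hz' : IsUnit (A z).det := isUnit_iff_ne_zero.2 hz
    let L : Cn n →ₗ[ℂ] Cn n := (Matrix.toEuclideanCLM (𝕜 := ℂ) (A z)).toLinearMap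
    have hLinv : ∀ v, act (A z) (act (A z)⁻¹ v) = v := fun v => by
      rw [← act_mul, Matrix.mul_nonsing_inv _ hz', act_one]
    have hLinv' : ∀ v, act (A z)⁻¹ (act (A z) v) = v := fun v => by
      rw [← act_mul, Matrix.nonsing_inv_mul _ hz', act_one]
    have hLinj : Function.Injective L := fun v w h => by
      rw [← hLinv' v, ← hLinv' w]
      exact congrArg _ h
    have hbasis : LinearIndependent ℂ fun i => (Module.finBasis ℂ (α z₀) i : Cn n) :=
      (Module.finBasis ℂ (α z₀)).linearIndependent.map' (α z₀).subtype (Submodule.ker_subtype _)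
    have hspan : Submodule.span ℂ (Set.range fun i => (Module.finBasis ℂ (α z₀) i : Cn n))
        = α z₀ := by
      have h := congrArg (Submodule.map (α z₀).subtype) (Module.finBasis ℂ (α z₀)).span_eq
      rw [Submodule.map_span, ← Set.range_comp, Submodule.map_top, Submodule.range_subtype] at h
      exact h
    refine ⟨hbasis.map' L (LinearMap.ker_eq_bot.2 hLinj), ?_⟩
    have h1 : (Set.range fun i => act (A z) (Module.finBasis ℂ (α z₀) i))
        = L '' Set.range fun i => (Module.finBasis ℂ (α z₀) i : Cn n) := by
      rw [← Set.range_comp]; rfl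
    rw [h1, ← Submodule.map_span, hspan]
    ext w
    rw [hα, Submodule.mem_map]
    constructor
    · rintro ⟨v, hv, rfl⟩
      change act (Q z) (act (A z) v) = act (A z) v
      rw [← act_mul, ← hcomm, act_mul, (hα z₀ v).1 hv]
    · intro hw
      refine ⟨act (A z)⁻¹ w, (hα z₀ _).2 (hLinj ?_), hLinv w⟩
      change act (A z) (act (Q z₀) _) = act (A z) (act (A z)⁻¹ w)
      rw [← act_mul, hcomm, act_mul, hLinv, hw]

end SmoothMatrices

/-! ### Smooth local roots on the circle. -/

section CircleRoots

attribute [local instance] finrank_real_complex_fact'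

theorem contMDiff_coe_circle : ContMDiff (𝓡 1) 𝓘(ℝ, ℂ) ∞ fun x : Circle => (x : ℂ) :=
  contMDiff_coe_sphere

/-- Near every point there is a smooth choice of `k`-th roots on the circle. -/
theorem exists_smooth_root (k : ℕ) [NeZero k] (x₀ : Circle) :
    ∃ ρ : Circle → Circle, (∀ x, ρ x ^ k = x) ∧ ContMDiffAt (𝓡 1) (𝓡 1) ∞ ρ x₀ := by
  -- Rotating `x₀` to `1` moves away from the branch cut of the argument; a fixed root of `x₀`
  -- compensates.
  refine ⟨fun x => argRoot k (x * x₀⁻¹) * argRoot k x₀, fun x => ?_, ?_⟩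
  · rw [mul_pow, argRoot_pow, argRoot_pow, inv_mul_cancel_right]
  · have h1 : ContMDiff (𝓡 1) 𝓘(ℝ, ℂ) ∞ fun x : Circle => ((x * x₀⁻¹ : Circle) : ℂ) :=
      contMDiff_coe_circle.comp contMDiff_mul_right
    have h2 : ContDiffAt ℝ ∞ (fun w : ℂ => Complex.arg w / k) 1 := by
      simp only [← Complex.log_im]
      exact (Complex.imCLM.contDiff.contDiffAt.comp (1 : ℂ)
        ((Complex.contDiffAt_log Complex.one_mem_slitPlane).restrict_scalars ℝ)).div_const _
    have h3 : ContMDiffAt (𝓡 1) 𝓘(ℝ, ℝ) ∞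
        (fun x : Circle => Complex.arg ((x * x₀⁻¹ : Circle) : ℂ) / k) x₀ := by
      refine ContDiffAt.comp_contMDiffAt (g := fun w : ℂ => Complex.arg w / k) ?_ (h1 x₀)
      simpa using h2
    have h4 : ContMDiffAt (𝓡 1) (𝓡 1) ∞ (fun x : Circle => argRoot k (x * x₀⁻¹)) x₀ :=
      (contMDiff_circleExp.contMDiffAt).comp x₀ h3
    exact contMDiff_mul_right.contMDiffAt.comp x₀ h4

end CircleRoots

/-! ### Smooth families over the manifold. -/

section Families

variable {n k : ℕ} [NeZero k] {ξ : Circle} {E : Type*} [NormedAddCommGroup E] [NormedSpace ℝ E]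
  {H : Type*} [TopologicalSpace H] {I : ModelWithCorners ℝ E H} {M : Type*} [TopologicalSpace M]
  [ChartedSpace H M] {Φ : Circle → M → Mat n}

theorem SmoothFamily.slice (hΦ : SmoothFamily I Φ) (x : Circle) :
    IsSmoothMatrix I fun z => Φ x z :=
  IsSmoothMatrix.comp (F := fun p : Circle × M => Φ p.1 p.2) hΦ
    (contMDiff_const.prodMk contMDiff_id)

theorem SmoothFamily.continuous_left (hΦ : SmoothFamily I Φ) (z : M) :
    Continuous fun x => Φ x z :=
  (IsSmoothMatrix.continuous (F := fun p : Circle × M => Φ p.1 p.2) hΦ).comp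
    (continuous_id.prodMk continuous_const)

theorem SmoothFamily.isMeasurable (hΦ : SmoothFamily I Φ) (z : M) :
    IsMeasurable fun x => Φ x z :=
  isMeasurable_of_continuous fun a b => (hΦ.continuous_left z).matrix_elem a b

/-- In the continuous case the monodromy relation holds everywhere. -/
theorem SmoothFamily.monodromy (hξ : IsPrimitiveRoot ξ k) (hΦ : SmoothFamily I Φ)
    (hU : ∀ x z, Φ x z ∈ Un n) (h1 : ∀ z, Φ 1 z = 1) {z : M} {W : Submodule ℂ (L2 n)}
    (hW : W = mulImage (fun x => Φ x z) (hardy n)) (hsym : IsSymmetric ξ W) :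
    Φ ξ z ^ k = 1 ∧ ∀ x, Φ (ξ * x) z = Φ x z * Φ ξ z := by
  obtain ⟨φ, -, hae⟩ := exists_monodromy hξ.pow_eq_one hsym (hΦ.isMeasurable z)
    (Eventually.of_forall fun x => hU x z) hW
  have hc := hΦ.continuous_left z
  -- Haar measure charges nonempty open sets, so continuous functions equal almost everywhere are
  -- equal.
  have heq : (fun x => Φ (ξ * x) z) = fun x => Φ x z * φ :=
    (Continuous.ae_eq_iff_eq circleMeasure (hc.comp (continuous_const_mul ξ))
      (hc.matrix_mul continuous_const)).1 hae
  have hφ : Φ ξ z = φ := by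
    have := congrFun heq 1
    simpa [h1] using this
  rw [hφ]
  exact ⟨monodromy_pow_eq_one hξ.pow_eq_one (Eventually.of_forall fun x => hU x z) hae,
    congrFun heq⟩

/-- The Laurent factor is polynomial in `λ` and in `Φ ξ z`, hence jointly smooth, and so is its
adjoint. -/
theorem SmoothFamily.untwist (hξ : IsPrimitiveRoot ξ k) (hΦ : SmoothFamily I Φ)
    (hU : ∀ x z, Φ x z ∈ Un n) (hk : ∀ z, Φ ξ z ^ k = 1) :
    SmoothFamily I fun x z => untwist k ξ (Φ ξ z) (fun y => Φ y z) x := by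
  have h1 : IsSmoothMatrix ((𝓡 1).prod I) fun p : Circle × M => Φ p.1 p.2 *
      star (laurent k (spectralProj k ξ (Φ ξ p.2)) p.1) := by
    refine IsSmoothMatrix.mul hΦ (IsSmoothMatrix.star (IsSmoothMatrix.sum _ fun j _ =>
      IsSmoothMatrix.smul ?_ (((hΦ.slice ξ).comp contMDiff_snd).spectralProj k ξ j)))
    exact (contDiff_id.pow j).comp_contMDiff (contMDiff_coe_circle.comp contMDiff_fst)
  intro a b
  refine (h1 a b).congr fun p => ?_
  exact congrFun₂ (untwist_eq hξ (NeZero.pos k) (hU ξ p.2) (hk p.2) (fun y => Φ y p.2) p.1) a b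

/-- A smooth family which factors through `λ ↦ λᵏ` descends to a smooth family. -/
theorem SmoothFamily.of_comp_pow {Ψ : Circle → M → Mat n}
    (h : SmoothFamily I fun x z => Ψ (x ^ k) z) : SmoothFamily I Ψ := by
  rintro a b ⟨x₀, z₀⟩
  -- Composing the smooth map `Ψ(λᵏ)` with any right inverse of the power map gives `Ψ`, so one that
  -- is smooth at `x₀` suffices.
  obtain ⟨ρ, hρ, hs⟩ := exists_smooth_root k x₀
  have h1 : ContMDiffAt ((𝓡 1).prod I) ((𝓡 1).prod I) ∞
      (fun p : Circle × M => (ρ p.1, p.2)) (x₀, z₀) :=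
    (hs.comp (x₀, z₀) contMDiffAt_fst).prodMk contMDiffAt_snd
  have h2 := ((h a b) (ρ x₀, z₀)).comp (x₀, z₀) h1
  refine h2.congr_of_eventuallyEq (Eventually.of_forall fun p => ?_)
  simp [hρ]

theorem SmoothFamily.isSmoothSubbundle_alpha (hξ : IsPrimitiveRoot ξ k) (hΦ : SmoothFamily I Φ)
    (hU : ∀ x z, Φ x z ∈ Un n) (hk : ∀ z, Φ ξ z ^ k = 1) {j : ℕ} (hj : j < k) :
    IsSmoothSubbundle I fun z => alpha ξ (Φ ξ z) j := by
  have hP := fun z => isProjFamily_spectralProj hξ (NeZero.pos k) (hU ξ z) (hk z)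
  refine isSmoothSubbundle_of_idempotent
    (Q := fun z => ∑ l ∈ range (j + 1), spectralProj k ξ (Φ ξ z) l)
    (IsSmoothMatrix.sum _ fun l _ => (hΦ.slice ξ).spectralProj k ξ l)
    (fun z => (hP z).isIdempotentElem_partialSum hj) fun z v => ?_
  rw [mem_alpha hξ (hk z) hj, (hP z).act_partialSum_eq_self_iff hj]

end Families

end KSymmetric

/-! ### Assembly of the measurable and smooth cases. -/

theorem proposition3p3 (n k : ℕ) [NeZero k] (hk : 2 ≤ k) (ω : Circle) (hω : IsPrimitiveRoot ω k)
    {E : Type*} [NormedAddCommGroup E] [NormedSpace ℝ E] {H : Type*} [TopologicalSpace H]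
    (I : ModelWithCorners ℝ E H) {M : Type*} [TopologicalSpace M] [ChartedSpace H M]
    [IsManifold I (⊤ : ℕ∞) M] :
    -- the measurable case
    (∀ (W : Submodule ℂ (L2 n)) (Φ : Circle → Mat n),
      IsSymmetric ω W → IsMeasurable Φ → (∀ᵐ x ∂circleMeasure, Φ x ∈ Un n) →
      W = mulImage Φ (hardy n) →
      ∃ φ ∈ Un n, φ ^ k = 1 ∧
        (∀ᵐ x ∂circleMeasure, Φ (ω * x) = Φ x * φ) ∧
        -- the sums defining the `α_j` are orthogonal
        (∀ i < k, ∀ j < k, i ≠ j → beta ω φ i ⟂ beta ω φ j) ∧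
        -- `Φ_k` is a function of `λᵏ`
        (∃ F : Circle → Mat n, IsMeasurable F ∧
          ∀ᵐ x ∂circleMeasure, untwist k ω φ Φ x = F (x ^ k)) ∧
        -- `Ψ(λ) = Φ_k(λ^{1/k})` for an arbitrary choice `root` of `k`-th roots
        (∀ root : Circle → Circle, (∀ x, root x ^ k = x) →
          (∀ᵐ x ∂circleMeasure, untwist k ω φ Φ x = untwist k ω φ Φ (root (x ^ k))) ∧
          Represents k ω W (fun x => untwist k ω φ Φ (root x)) (alpha ω φ))) ∧
    -- the smooth case
    (∀ (W : M → Submodule ℂ (L2 n)) (Φ : Circle → M → Mat n),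
      SmoothFamily I Φ → (∀ x z, Φ x z ∈ Un n) → (∀ z, Φ 1 z = 1) →
      (∀ z, W z = mulImage (fun x => Φ x z) (hardy n)) → (∀ z, IsSymmetric ω (W z)) →
      ∃ φ : M → Mat n,
        (∀ z, φ z ∈ Un n ∧ φ z ^ k = 1 ∧ (∀ x, Φ (ω * x) z = Φ x z * φ z) ∧
          ∀ i < k, ∀ j < k, i ≠ j → beta ω (φ z) i ⟂ beta ω (φ z) j) ∧
        (∀ j, j + 2 ≤ k → IsSmoothSubbundle I (fun z => alpha ω (φ z) j)) ∧
        ∀ root : Circle → Circle, (∀ x, root x ^ k = x) →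
          ∀ Ψ : Circle → M → Mat n,
            (∀ x z, Ψ x z = untwist k ω (φ z) (fun y => Φ y z) (root x)) →
            (∀ x z, untwist k ω (φ z) (fun y => Φ y z) x = Ψ (x ^ k) z) ∧
            (∀ z, Represents k ω (W z) (fun x => Ψ x z) (alpha ω (φ z))) ∧
            (∀ x z, Ψ x z ∈ Un n) ∧ SmoothFamily I Ψ ∧ (∀ z, Ψ 1 z = 1)) := by
  refine ⟨fun W Φ hsym hm hU hW => ?_, fun W Φ hΦ hU h1 hW hsym => ?_⟩
  · obtain ⟨φ, hφ, hae⟩ := exists_monodromy hω.pow_eq_one hsym hm hU hW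
    have hφk := monodromy_pow_eq_one hω.pow_eq_one hU hae
    exact ⟨φ, hφ, hφk, hae, fun i hi j hj hij => isOrtho_beta hω hφ hφk hi hj hij,
      exists_untwist_eq_comp_pow hω hφ hφk hm hae, fun root hroot =>
        ⟨ae_untwist_root hω hφ hφk hae hroot, represents_untwist hk hω hφ hφk hm hU hae hW hroot⟩⟩
  · have hmon := fun z => hΦ.monodromy hω hU h1 (hW z) (hsym z)
    have hφk := fun z => (hmon z).1
    have hrel := fun z => (hmon z).2
    -- The normalization at `λ = 1` forces the monodromy to be `Φ ω z`, which is smooth in `z`.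
    refine ⟨fun z => Φ ω z, fun z => ⟨hU ω z, hφk z, hrel z, fun i hi j hj hij =>
      isOrtho_beta hω (hU ω z) (hφk z) hi hj hij⟩,
      fun j hj => hΦ.isSmoothSubbundle_alpha hω hU hφk (by omega), fun root hroot Ψ hΨ => ?_⟩
    have hpow : ∀ x z, untwist k ω (Φ ω z) (fun y => Φ y z) x = Ψ (x ^ k) z := fun x z => by
      rw [hΨ]
      exact untwist_eq_of_pow_eq hω (hU ω z) (hφk z) (hrel z) (hroot (x ^ k)).symm
    refine ⟨hpow, fun z => ?_, fun x z => ?_, SmoothFamily.of_comp_pow (k := k) ?_, fun z => ?_⟩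
    · have h := represents_untwist hk hω (hU ω z) (hφk z) (hΦ.isMeasurable z)
        (Filter.Eventually.of_forall fun x => hU x z) (Filter.Eventually.of_forall (hrel z)) (hW z)
        hroot
      simp only [hΨ]
      exact h
    · rw [hΨ]
      exact untwist_mem hω (hU ω z) (hφk z) (hU _ z)
    · simp only [← hpow]
      exact hΦ.untwist hω hU hφk
    -- At `1 = 1^k` the value is `Φ 1 z` times the adjoint of the sum of all spectral projections,
    -- which is the identity.
    · rw [← one_pow (M := Circle) k, ← hpow, untwist_eq hω (NeZero.pos k) (hU ω z) (hφk z), h1,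
        one_mul, laurent_one, sum_spectralProj hω (NeZero.pos k), star_one]
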